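/- **Setting.** Let $E_1,\dots,E_m$ be distinct non-identity tensor products of Pauli matrices on $n$ qubits, each supported on at most $k$ qubits, whose dual interaction graph $\mathfrak G$ (vertices $1,\dots,m$; $a\neq b$ adjacent iff $\operatorname{supp}(E_a)\cap\operatorname{supp}(E_b)\ne\emptyset$) has maximum degree at most $d$. Let $H=\sum_a\lambda_aE_a$ with $\lambda_a\in[-1,1]$ and $\rho=e^{-\beta H}/\operatorname{Tr}e^{-\beta H}$. For an integer $\ell$, let $\mathcal P_{k\ell}$ be the set of Pauli strings $P$ with $\operatorname{supp}(P)\subseteq\bigcup_{a\in S}\operatorname{supp}(E_a)$ for some nonempty $S\subseteq[m]$ that is connected in $\mathfrak G$ and has at most $\ell$ elements; for a real number $r \ge 0$, $\mathcal P_{r}$ means $|S|\le r/k$. Given $C,\beta>0$ and $\varepsilon\in(0,1)$, put $$\varepsilon_0=\varepsilon^{10^{C\beta}}/m^3,\quad \ell_0=\lceil 2^{C\beta}\log(1/\varepsilon)\rceil,\quad \mathcal A=\mathcal P_{4^{C\beta}\ell_0},\quad \mathcal B=\mathcal P_{4k}.$$ Let $s_\ell(x)=\sum_{j\le\ell}x^j/j!$,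 $p_{K,\ell}(x)=\prod_{j=1}^{K}s_{2^j\ell}(x/K)$, $q_{K,\ell}(x)=1+\int_0^xp_{K,\ell}(y)\,dy$, and $q=q_{\lceil C\beta\rceil,\ell_0}$. For $q(x)=\sum_jq_jx^j$ write $q(X|A)=\sum_jq_j[X,A]_j$, where $[X,A]_0=A$ and $[X,A]_{j+1}=[X,[X,A]_j]$. The trace estimates are given by a complex-linear functional $M\mapsto\widetilde{\operatorname{tr}}(M\rho)$ on operators; traces $\widetilde{\operatorname{tr}}(A(H'\rho-\rho H'))$ are understood as $\widetilde{\operatorname{tr}}((AH'-H'A)\rho)$. The estimates are *accurate* if $|\widetilde{\operatorname{tr}}(A_1A_2A_3\rho)-\operatorname{tr}(A_1A_2A_3\rho)|\le\varepsilon_0$ for all $A_1,A_2,A_3\in\mathcal A$. In real indeterminates $\lambda'_1,\dots,\lambda'_m$, with $H'=\sum_a\lambda'_aE_a$, let $\mathcal C_{\lambda'}$ be the polynomial system - $-1\le\lambda'_a\le1$ for $a\in[m]$; - $|\widetilde{\operatorname{tr}}(A_1A_2(H'\rho-\rho H'))|^2\le\varepsilon_0^2$ for $A_1,A_2\in\mathcal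 A$; - $|\widetilde{\operatorname{tr}}(B_2\,q(-\beta H'|B_1)\rho)-\widetilde{\operatorname{tr}}(B_1B_2\rho)|^2\le\varepsilon^2$ for $B_1,B_2\in\mathcal B$. A degree-$D$ sum-of-squares proof of $g\ge0$ from $\mathcal C_{\lambda'}$ is an identity $g=\sum_jp_j^2\prod_{f\in S_j}f$ with real polynomials $p_j$ and finite sets $S_j$ of polynomials $f$ for which $f\ge 0$ is a constraint of $\mathcal C_{\lambda'}$, every summand having degree at most $D$. **Lemma (SoS finds an almost-commuting state).** For all $k,d$ and every $\beta_0>0$ there are positive constants $C_0,c,f$, depending only on $k,d,\beta_0$, such that for all $C\ge C_0$, all $\beta\ge\beta_0$ and all $n,m,E,\lambda,\varepsilon\in(0,1)$ as above, if the estimates are accurate, then the following holds. There are real linear forms $\gamma_F$ in $\lambda'$ with $$\mathrm i[H,H']=\sum_{F\in\mathcal P_{2k}}\gamma_FF,$$ and for any such $\gamma_F$ there is $D\le\max\{2,\ \log(1/\varepsilon)^{2^{f\beta}}\}$ such that, for every $F\in\mathcal P_{2k}$, both inequalities $$-e^{c\beta}m^{1.5}\sqrt{\varepsilon_0}\ \le\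 \gamma_F\ \le\ e^{c\beta}m^{1.5}\sqrt{\varepsilon_0}$$ have degree-$D$ sum-of-squares proofs from $\mathcal C_{\lambda'}$. -/

import Mathlib

noncomputable section

namespace HamLearn

/-! ### Pauli operators on `n` qubits -/

/-- Labels of the four single-qubit Pauli matrices. -/
inductive Pauli where
  | I | X | Y | Z
  deriving DecidableEq

instance : Fintype Pauli where
  elems := {.I, .X, .Y, .Z}
  complete := fun P => by cases P <;> decide

/-- The single-qubit Pauli matrices. -/
def Pauli.mat : Pauli → Matrix (Fin 2) (Fin 2) ℂ
  | .I => !![1, 0; 0, 1]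
  | .X => !![0, 1; 1, 0]
  | .Y => !![0, -Complex.I; Complex.I, 0]
  | .Z => !![1, 0; 0, -1]

/-- A tensor product of Pauli matrices on `n` qubits, given by its tensor factors. -/
abbrev PauliString (n : ℕ) := Fin n → Pauli

/-- Operators on `(ℂ²)^{⊗ n}`, in the computational basis `{0,1}^n`. -/
abbrev Op (n : ℕ) := Matrix (Fin n → Fin 2) (Fin n → Fin 2) ℂ

/-- The matrix `P₁ ⊗ ⋯ ⊗ Pₙ`. -/
def PauliString.op {n : ℕ} (P : PauliString n) : Op n :=
  Matrix.of fun x y => ∏ i, (P i).mat (x i) (y i)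

/-- The qubits on which `P` acts non-trivially. -/
def PauliString.supp {n : ℕ} (P : PauliString n) : Finset (Fin n) :=
  Finset.univ.filter fun i => P i ≠ Pauli.I

/-! ### Hamiltonians, Gibbs states, locality -/

/-- `H = ∑ₐ λₐ Eₐ`. -/
def hamiltonian {n m : ℕ} (E : Fin m → PauliString n) (lam : Fin m → ℝ) : Op n :=
  ∑ a, (lam a : ℂ) • (E a).op

/-- `exp(-β H) / Tr exp(-β H)`. -/
def gibbs {n : ℕ} (β : ℝ) (H : Op n) : Op n :=
  (Matrix.trace (NormedSpace.exp (-(β : ℂ) • H)))⁻¹ • NormedSpace.exp (-(β : ℂ) • H)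

/-- The dual interaction graph: distinct terms are adjacent iff their supports intersect. -/
def dualGraph {n m : ℕ} (E : Fin m → PauliString n) : SimpleGraph (Fin m) where
  Adj a b := a ≠ b ∧ ((E a).supp ∩ (E b).supp).Nonempty
  symm := ⟨fun _ _ h => ⟨h.1.symm, by rw [Finset.inter_comm]; exact h.2⟩⟩
  loopless := ⟨fun _ h => h.1 rfl⟩

open Classical in
/-- The Pauli strings whose support is covered by the supports of a connected set of at most `ℓ`
terms. For a `k`-local Hamiltonian these are the `kℓ`-`𝔊`-local Pauli matrices `𝒫_{kℓ}`. -/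
def localPaulis {n m : ℕ} (E : Fin m → PauliString n) (ℓ : ℕ) : Finset (PauliString n) :=
  Finset.univ.filter fun P => ∃ S : Finset (Fin m), S.card ≤ ℓ ∧
    ((dualGraph E).induce (S : Set (Fin m))).Connected ∧ P.supp ⊆ S.biUnion fun a => (E a).supp

/-- `E₁, …, E_m` are distinct non-identity Pauli operators, each supported on at most `k` qubits,
whose dual interaction graph has maximum degree at most `d`. -/
structure IsLowIntersection {n m : ℕ} (k d : ℕ) (E : Fin m → PauliString n) : Prop where
  distinct : Function.Injective E
  ne_one : ∀ a, E a ≠ fun _ => Pauli.I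
  card_supp : ∀ a, (E a).supp.card ≤ k
  degree_le : ∀ a, ((dualGraph E).neighborSet a).ncard ≤ d

/-! ### Commutator polynomials and the polynomial `q` -/

/-- The nested commutator `[X, A]_j`, with `[X, A]_0 = A`. -/
def nestedComm {R : Type*} [Ring R] (X A : R) : ℕ → R
  | 0 => A
  | j + 1 => X * nestedComm X A j - nestedComm X A j * X

/-- `p(X | A) = ∑ⱼ pⱼ [X, A]_j`. -/
def commPoly {R : Type*} [Ring R] [Module ℝ R] (p : Polynomial ℝ) (X A : R) : R :=
  p.sum fun j c => c • nestedComm X A j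

/-- The truncated exponential series `s_ℓ(x) = ∑_{j ≤ ℓ} x^j / j!`. -/
def truncExp (ℓ : ℕ) : Polynomial ℝ :=
  ∑ j ∈ Finset.range (ℓ + 1), Polynomial.C (1 / (j.factorial : ℝ)) * Polynomial.X ^ j

/-- `p_{K,ℓ}(x) = s_{2ℓ}(x/K) s_{4ℓ}(x/K) ⋯ s_{2^K ℓ}(x/K)`. -/
def flatP (K ℓ : ℕ) : Polynomial ℝ :=
  ∏ j ∈ Finset.Icc 1 K,
    (truncExp (2 ^ j * ℓ)).comp (Polynomial.C (1 / (K : ℝ)) * Polynomial.X)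

/-- `q_{K,ℓ}(x) = 1 + ∫₀ˣ p_{K,ℓ}(y) dy`, integrating monomial by monomial. -/
def flatQ (K ℓ : ℕ) : Polynomial ℝ :=
  1 + (flatP K ℓ).sum fun j c => Polynomial.C (c / ((j : ℝ) + 1)) * Polynomial.X ^ (j + 1)

/-! ### Sum-of-squares proofs -/

/-- `{f ≥ 0 : f ∈ 𝒞} ⊢_ℓ {g ≥ 0}`: `g = ∑_S σ_S ∏_{f ∈ S} f` over finite `S ⊆ 𝒞` with `σ_S` sums of
squares, each term `p² ∏_{f ∈ S} f` having degree at most `ℓ`. -/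
def SoSProves {σ : Type*} (𝒞 : Set (MvPolynomial σ ℝ)) (ℓ : ℕ) (g : MvPolynomial σ ℝ) : Prop :=
  ∃ (N : ℕ) (p : Fin N → MvPolynomial σ ℝ) (S : Fin N → Finset (MvPolynomial σ ℝ)),
    (∀ j, (S j : Set (MvPolynomial σ ℝ)) ⊆ 𝒞) ∧
    (∀ j, (p j ^ 2 * ∏ f ∈ S j, f).totalDegree ≤ ℓ) ∧
    g = ∑ j, p j ^ 2 * ∏ f ∈ S j, f

/-! ### The constraint system -/

/-- The real polynomial `|p|²` for a complex polynomial `p` in real indeterminates: the sum of the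
squares of its coefficientwise real and imaginary parts. -/
def normSqPoly {σ : Type*} (p : MvPolynomial σ ℂ) : MvPolynomial σ ℝ :=
  (∑ e ∈ p.support, MvPolynomial.monomial e (p.coeff e).re) ^ 2 +
    (∑ e ∈ p.support, MvPolynomial.monomial e (p.coeff e).im) ^ 2

/-- Operators whose entries are polynomials in the indeterminates `λ'₁, …, λ'_m`. -/
abbrev PolyOp (n m : ℕ) := Matrix (Fin n → Fin 2) (Fin n → Fin 2) (MvPolynomial (Fin m) ℂ)

/-- A Pauli string as an operator with constant polynomial entries. -/
def constOp {n : ℕ} (m : ℕ) (P : PauliString n) : PolyOp n m :=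
  P.op.map (fun z => MvPolynomial.C z)

/-- `H' = ∑ₐ λ'ₐ Eₐ`, with indeterminates `λ'ₐ`. -/
def indetHamiltonian {n m : ℕ} (E : Fin m → PauliString n) : PolyOp n m :=
  ∑ a, (MvPolynomial.X a : MvPolynomial (Fin m) ℂ) • constOp m (E a)

/-- Extension of a linear functional on operators to operators with polynomial entries, linearly
over the polynomials. -/
def extendEst {n m : ℕ} (T : Op n →ₗ[ℂ] ℂ) (M : PolyOp n m) : MvPolynomial (Fin m) ℂ :=
  ∑ x, ∑ y, M x y * MvPolynomial.C (T (Matrix.single x y 1))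

/-- `ε₀ = ε^{10^{Cβ}} / m³`. -/
def eps0 (C β ε : ℝ) (m : ℕ) : ℝ := ε ^ ((10 : ℝ) ^ (C * β)) / (m : ℝ) ^ 3

/-- `ℓ₀ = 2^{Cβ} log(1/ε)`, rounded up to an integer. -/
def ell0 (C β ε : ℝ) : ℕ := ⌈(2 : ℝ) ^ (C * β) * Real.log (1 / ε)⌉₊

/-- `𝒜 = 𝒫_{4^{Cβ} ℓ₀}`: Pauli strings covered by connected sets of at most `4^{Cβ} ℓ₀ / k` terms. -/
def setA {n m : ℕ} (k : ℕ) (C β ε : ℝ) (E : Fin m → PauliString n) : Finset (PauliString n) :=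
  localPaulis E ⌊(4 : ℝ) ^ (C * β) * (ell0 C β ε : ℝ) / (k : ℝ)⌋₊

/-- `ℬ = 𝒫_{4k}`. -/
def setB {n m : ℕ} (E : Fin m → PauliString n) : Finset (PauliString n) := localPaulis E 4

/-- The estimates are accurate: `T M` is the estimate of `tr(M ρ)`, and for all `A₁, A₂, A₃ ∈ 𝒜`
the estimate of `tr(A₁ A₂ A₃ ρ)` is within `ε₀` of its true value. -/
def AccurateEstimates {n m : ℕ} (k : ℕ) (C β ε : ℝ) (E : Fin m → PauliString n) (ρ : Op n)
    (T : Op n →ₗ[ℂ] ℂ) : Prop :=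
  ∀ A₁ ∈ setA k C β ε E, ∀ A₂ ∈ setA k C β ε E, ∀ A₃ ∈ setA k C β ε E,
    ‖T (A₁.op * A₂.op * A₃.op) - Matrix.trace (A₁.op * A₂.op * A₃.op * ρ)‖ ≤ eps0 C β ε m

/-- The polynomials `g` of the constraints `g ≥ 0` of the system `𝒞_{λ'}`:
* `-1 ≤ λ'ₐ ≤ 1`;
* `|t̃r(A₁A₂(H'ρ - ρH'))|² ≤ ε₀²` for `A₁, A₂ ∈ 𝒜`, where `t̃r(A₁A₂(H'ρ - ρH'))` stands for the
  estimate of the trace of `(A₁A₂H' - H'A₁A₂)ρ`;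
* `|t̃r(B₂ q(-βH' | B₁) ρ) - t̃r(B₁B₂ρ)|² ≤ ε²` for `B₁, B₂ ∈ ℬ`, with `q = q_{⌈Cβ⌉, ℓ₀}`. -/
def constraintSystem {n m : ℕ} (k : ℕ) (C β ε : ℝ) (E : Fin m → PauliString n)
    (T : Op n →ₗ[ℂ] ℂ) : Set (MvPolynomial (Fin m) ℝ) :=
  {g | ∃ a : Fin m, g = MvPolynomial.X a + 1 ∨ g = 1 - MvPolynomial.X a} ∪
  {g | ∃ A₁ ∈ setA k C β ε E, ∃ A₂ ∈ setA k C β ε E,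
    g = MvPolynomial.C (eps0 C β ε m ^ 2) - normSqPoly (extendEst T
      (constOp m A₁ * constOp m A₂ * indetHamiltonian E -
        indetHamiltonian E * constOp m A₁ * constOp m A₂))} ∪
  {g | ∃ B₁ ∈ setB E, ∃ B₂ ∈ setB E,
    g = MvPolynomial.C (ε ^ 2) - normSqPoly
      (extendEst T (constOp m B₂ *
          commPoly (flatQ ⌈C * β⌉₊ (ell0 C β ε)) ((-β) • indetHamiltonian E) (constOp m B₁)) -
        extendEst T (constOp m B₁ * constOp m B₂))}

/-- The linear forms `γ_F` in `λ'` are the coefficients of a representation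
`i[H, H'] = ∑_{F ∈ 𝒫_{2k}} γ_F F`, where `H = ∑ₐ λₐ Eₐ` and `H' = ∑ₐ λ'ₐ Eₐ`. -/
def IsCommutatorExpansion {n m : ℕ} (E : Fin m → PauliString n) (lam : Fin m → ℝ)
    (γ : PauliString n → MvPolynomial (Fin m) ℝ) : Prop :=
  (∀ F ∈ localPaulis E 2, (γ F).IsHomogeneous 1) ∧
  ∀ lam' : Fin m → ℝ,
    Complex.I • (hamiltonian E lam * hamiltonian E lam' - hamiltonian E lam' * hamiltonian E lam) =
      ∑ F ∈ localPaulis E 2, (MvPolynomial.eval lam' (γ F) : ℂ) • F.op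

end HamLearn

end

/-! Write X = i[H,H'] and consider the quadratic form Q(λ') = -tr([H,H'][H',ρ]) (`production`). It
is squeezed between a multiple of γ_F² and a small constant, and both inequalities have
sum-of-squares proofs of degree two.

Upper bound (`sosProves_production`). Q is a combination of products λ'_b · tr(E_a E_b [E_c,ρ]) λ'_c
over pairs a, b with intersecting supports. The commutator constraints with A₁, A₂ among the E_a,
the box constraints and the accuracy of the estimates give Q ≤ K := 6(d+1)m²ε₀.

Lower bound, at real points. In an eigenbasis of H, both Q and tr(X²ρ) are weighted sums of
|H'_ij|². Comparing weights (`mean_ineq`) gives Q ≥ β/(1+βm) · tr(X²ρ), because the energies are at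
most m in modulus. Moreover tr(X²ρ) ≥ κ e^{-βΔ} γ_F² (`exists_variance_bound`). If the second moment
were smaller, the state would sit almost entirely on small spectral values of X. A local Pauli
changes the energy by O(1), so applying one raises the weight of the rare large values by at most
e^{O(β)}, up to a small error (`GibbsBasis.norm_sq_proj_mul_le`). All locally rotated states would
then see a small X. A signed average of Pauli conjugations of X - PXP nevertheless isolates a
dominant coefficient, which is a contradiction.

Together these give Q ≥ qγ_F² at every real point. Since Q - qγ_F² is a quadratic form, being
nonnegative everywhere makes it a sum of squares of linear forms (`SoSProves.quadForm`). Hence γ_F²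
≤ K/q = e^{O(β)} m³ε₀ has a degree-two proof, and `SoSProves.bound_of_sq_le` takes the square root.

Norms are Frobenius norms and V = `gibbsRoot U r` satisfies VVᴴ = ρ, so ‖MV‖² is the expectation of
MᴴM in ρ. -/

noncomputable section

namespace HamLearn

open Matrix

/-! ### Pauli algebra -/

/-- The Pauli label of the product of two Pauli matrices. -/
def Pauli.mul : Pauli → Pauli → Pauli
  | .I, Q => Q
  | P, .I => P
  | .X, .X => .I
  | .Y, .Y => .I
  | .Z, .Z => .I
  | .X, .Y => .Z
  | .Y, .X => .Z
  | .Y, .Z => .X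
  | .Z, .Y => .X
  | .Z, .X => .Y
  | .X, .Z => .Y

/-- The scalar in the product of two Pauli matrices. -/
def Pauli.phase : Pauli → Pauli → ℂ
  | .X, .Y => Complex.I
  | .Y, .X => -Complex.I
  | .Y, .Z => Complex.I
  | .Z, .Y => -Complex.I
  | .Z, .X => Complex.I
  | .X, .Z => -Complex.I
  | _, _ => 1

/-- The sign with which two Pauli matrices commute. -/
def Pauli.sgn (P Q : Pauli) : ℝ := if P = .I ∨ Q = .I ∨ P = Q then 1 else -1

theorem Pauli.mat_mul (P Q : Pauli) : P.mat * Q.mat = P.phase Q • (P.mul Q).mat := by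
  cases P <;> cases Q <;> ext i j <;> fin_cases i <;> fin_cases j <;>
    simp [Pauli.mat, Pauli.mul, Pauli.phase]

theorem Pauli.norm_phase (P Q : Pauli) : ‖P.phase Q‖ = 1 := by
  cases P <;> cases Q <;> simp [Pauli.phase]

theorem Pauli.mat_mul_comm (P Q : Pauli) : P.mat * Q.mat = (P.sgn Q : ℂ) • (Q.mat * P.mat) := by
  cases P <;> cases Q <;> ext i j <;> fin_cases i <;> fin_cases j <;>
    simp [Pauli.mat, Pauli.sgn]

theorem Pauli.mat_mul_self (P : Pauli) : P.mat * P.mat = 1 := by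
  cases P <;> ext i j <;> fin_cases i <;> fin_cases j <;> simp [Pauli.mat]

theorem Pauli.star_mat (P : Pauli) (i j : Fin 2) : star (P.mat i j) = P.mat j i := by
  cases P <;> fin_cases i <;> fin_cases j <;> simp [Pauli.mat]

theorem Pauli.mat_I : Pauli.I.mat = 1 := by
  ext i j; fin_cases i <;> fin_cases j <;> simp [Pauli.mat]

theorem Pauli.sum_mat (P : Pauli) : ∑ i, P.mat i i = if P = .I then 2 else 0 := by
  cases P <;> simp [Pauli.mat]; norm_num

theorem Pauli.univ_eq : (Finset.univ : Finset Pauli) = {.I, .X, .Y, .Z} := rfl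

theorem Pauli.sum_sgn_mul_sgn (P Q : Pauli) :
    ∑ R : Pauli, R.sgn P * R.sgn Q = if P = Q then 4 else 0 := by
  cases P <;> cases Q <;> simp [Pauli.univ_eq, Pauli.sgn] <;> norm_num

theorem Pauli.sgn_I_left (P : Pauli) : Pauli.I.sgn P = 1 := by simp [Pauli.sgn]

theorem Pauli.sgn_I_right (P : Pauli) : P.sgn .I = 1 := by simp [Pauli.sgn]

theorem Pauli.exists_sgn_eq_neg_one {P : Pauli} (h : P ≠ .I) : ∃ Q : Pauli, Q.sgn P = -1 := by
  cases P
  · exact absurd rfl h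
  · exact ⟨.Y, by simp [Pauli.sgn]⟩
  · exact ⟨.Z, by simp [Pauli.sgn]⟩
  · exact ⟨.X, by simp [Pauli.sgn]⟩

theorem Pauli.mul_eq_I_of {P Q : Pauli} (hP : P = .I) (hQ : Q = .I) : P.mul Q = .I := by
  subst hP hQ; rfl

namespace PauliString

variable {n : ℕ}

/-- The sign with which two Pauli strings commute. -/
def sgn (P Q : PauliString n) : ℝ := ∏ i, (P i).sgn (Q i)

theorem op_mul_apply (P Q : PauliString n) (x y : Fin n → Fin 2) :
    (P.op * Q.op) x y = ∏ i, ((P i).mat * (Q i).mat) (x i) (y i) := by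
  simp only [Matrix.mul_apply, op, Matrix.of_apply, ← Finset.prod_mul_distrib]
  rw [Finset.prod_univ_sum]
  simp

theorem op_mul_comm (P Q : PauliString n) : P.op * Q.op = (P.sgn Q : ℂ) • (Q.op * P.op) := by
  ext x y
  rw [Matrix.smul_apply, op_mul_apply, op_mul_apply, sgn, Complex.ofReal_prod, smul_eq_mul,
    ← Finset.prod_mul_distrib]
  refine Finset.prod_congr rfl fun i _ => ?_
  rw [Pauli.mat_mul_comm, Matrix.smul_apply, smul_eq_mul]

theorem op_mul (P Q : PauliString n) :
    P.op * Q.op = (∏ i, (P i).phase (Q i)) • PauliString.op fun i => (P i).mul (Q i) := by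
  ext x y
  rw [Matrix.smul_apply, op_mul_apply, op, Matrix.of_apply, smul_eq_mul,
    ← Finset.prod_mul_distrib]
  refine Finset.prod_congr rfl fun i _ => ?_
  rw [Pauli.mat_mul, Matrix.smul_apply, smul_eq_mul]

theorem exists_op_mul (P Q : PauliString n) : ∃ (R : PauliString n) (z : ℂ), ‖z‖ = 1 ∧
    R.supp ⊆ P.supp ∪ Q.supp ∧ P.op * Q.op = z • R.op := by
  refine ⟨_, _, ?_, ?_, op_mul P Q⟩
  · simp [Pauli.norm_phase]
  · intro i
    simp only [supp, Finset.mem_filter, Finset.mem_union, Finset.mem_univ, true_and]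
    contrapose!
    exact fun h => Pauli.mul_eq_I_of h.1 h.2

theorem op_I : PauliString.op (fun _ : Fin n => Pauli.I) = 1 := by
  ext x y
  simp only [op, Matrix.of_apply, Pauli.mat_I, Matrix.one_apply]
  by_cases h : x = y
  · simp [h]
  · obtain ⟨i, hi⟩ := Function.ne_iff.1 h
    rw [if_neg h, Finset.prod_eq_zero (Finset.mem_univ i) (if_neg hi)]

theorem op_mul_self (P : PauliString n) : P.op * P.op = 1 := by
  ext x y
  rw [op_mul_apply, ← op_I]
  simp [Pauli.mat_mul_self, op, Pauli.mat_I]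

theorem conjTranspose_op (P : PauliString n) : P.opᴴ = P.op := by
  ext x y
  simp only [Matrix.conjTranspose_apply, op, Matrix.of_apply, star_prod, Pauli.star_mat]

theorem op_ne_zero (P : PauliString n) : P.op ≠ 0 := fun h => by
  have := P.op_mul_self
  simp [h] at this

theorem trace_op (P : PauliString n) :
    P.op.trace = if P = fun _ => Pauli.I then 2 ^ n else 0 := by
  have h : P.op.trace = ∏ i, ∑ j, (P i).mat j j := by
    rw [Finset.prod_univ_sum]
    simp [Matrix.trace, op]
  rw [h]
  simp only [Pauli.sum_mat]
  by_cases hP : P = fun _ => Pauli.I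
  · simp [hP]
  · obtain ⟨i, hi⟩ := Function.ne_iff.1 hP
    rw [if_neg hP, Finset.prod_eq_zero (Finset.mem_univ i) (if_neg hi)]

theorem sgn_eq_one_of_disjoint {P Q : PauliString n} (h : Disjoint P.supp Q.supp) :
    P.sgn Q = 1 := by
  refine Finset.prod_eq_one fun i _ => ?_
  by_cases hP : P i = .I
  · rw [hP, Pauli.sgn_I_left]
  · have : i ∉ Q.supp := Finset.disjoint_left.1 h (by simpa [supp] using hP)
    have hQ : Q i = .I := by simpa [supp] using this
    rw [hQ, Pauli.sgn_I_right]

theorem sgn_eq_or (P Q : PauliString n) : P.sgn Q = 1 ∨ P.sgn Q = -1 := by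
  have : ∀ s : Finset (Fin n), (∏ i ∈ s, (P i).sgn (Q i)) = 1 ∨ (∏ i ∈ s, (P i).sgn (Q i)) = -1 := by
    intro s
    induction s using Finset.induction_on with
    | empty => simp
    | insert a s ha ih =>
      rw [Finset.prod_insert ha]
      have : (P a).sgn (Q a) = 1 ∨ (P a).sgn (Q a) = -1 := by
        unfold Pauli.sgn; split_ifs <;> simp
      rcases this with h | h <;> rcases ih with h' | h' <;> simp [h, h']
  exact this _

/-- The Pauli strings supported on a set of qubits. -/
def supported (R : Finset (Fin n)) : Finset (PauliString n) :=
  Fintype.piFinset fun i => if i ∈ R then Finset.univ else {Pauli.I}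

theorem mem_supported {R : Finset (Fin n)} {P : PauliString n} : P ∈ supported R ↔ P.supp ⊆ R := by
  simp only [supported, Fintype.mem_piFinset, Finset.subset_iff, supp, Finset.mem_filter,
    Finset.mem_univ, true_and]
  refine forall_congr' fun i => ?_
  by_cases h : i ∈ R <;> simp [h]

theorem card_supported (R : Finset (Fin n)) : (supported R).card = 4 ^ R.card := by
  have : ∀ i, (if i ∈ R then (Finset.univ : Finset Pauli) else {Pauli.I}).card =
      if i ∈ R then 4 else 1 := fun i => by split_ifs <;> rfl
  rw [supported, Fintype.card_piFinset]
  simp only [this, Finset.prod_ite_mem, Finset.univ_inter, Finset.prod_const]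

/-- Orthogonality of the sign characters, site by site. Outside R only the identity label is summed,
which contributes a factor 1. -/
theorem sum_sgn_mul_sgn (F G : PauliString n) (R : Finset (Fin n)) :
    ∑ Q ∈ supported R, Q.sgn F * Q.sgn G = if ∀ i ∈ R, F i = G i then 4 ^ R.card else 0 := by
  simp only [sgn, supported, ← Finset.prod_mul_distrib]
  rw [← Finset.prod_univ_sum (fun i => if i ∈ R then (Finset.univ : Finset Pauli) else {Pauli.I})
    (fun i q => q.sgn (F i) * q.sgn (G i))]
  have : ∀ i, ∑ q ∈ (if i ∈ R then (Finset.univ : Finset Pauli) else {Pauli.I}),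
      q.sgn (F i) * q.sgn (G i) = if i ∈ R then (if F i = G i then 4 else 0) else 1 := fun i => by
    split_ifs with h h' <;> simp [Pauli.sum_sgn_mul_sgn, Pauli.sgn_I_left, *]
  simp only [this, Finset.prod_ite_mem, Finset.univ_inter]
  split_ifs with h
  · rw [Finset.prod_congr rfl fun i hi => if_pos (h i hi), Finset.prod_const]
  · push Not at h
    obtain ⟨i, hi, hne⟩ := h
    exact Finset.prod_eq_zero hi (if_neg hne)

/-- P acts on a single site of the support of F, so its sign against G depends only on G at that
site. -/
theorem exists_sgn_eq_neg_one {F : PauliString n} (hF : F ≠ fun _ => Pauli.I) :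
    ∃ P ∈ supported F.supp, P.sgn F = -1 ∧
      ∀ G : PauliString n, (∀ i ∈ F.supp, F i = G i) → P.sgn G = -1 := by
  obtain ⟨i, hi⟩ := Function.ne_iff.1 hF
  obtain ⟨q, hq⟩ := Pauli.exists_sgn_eq_neg_one hi
  have key : ∀ G : PauliString n, F i = G i →
      sgn (Function.update (fun _ => Pauli.I) i q) G = -1 := by
    intro G hG
    rw [sgn, Finset.prod_eq_single i]
    · simpa [← hG] using hq
    · intro j _ hj
      simp [hj, Pauli.sgn_I_left]
    · simp
  have hmem : i ∈ F.supp := by simpa [supp] using hi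
  refine ⟨Function.update (fun _ => Pauli.I) i q, ?_, key F rfl, fun G hG => key G (hG i hmem)⟩
  rw [mem_supported]
  intro j hj
  by_cases hji : j = i
  · exact hji ▸ hmem
  · simp [supp, hji] at hj

theorem conj_op (P G : PauliString n) : P.op * G.op * P.op = (P.sgn G : ℂ) • G.op := by
  rw [op_mul_comm, smul_mul_assoc, mul_assoc, op_mul_self, mul_one]

end PauliString

/-! ### Frobenius norm estimates -/

section Frobenius

open scoped Matrix.Norms.Frobenius

variable {ι : Type*} [Fintype ι]

theorem frobenius_norm_sq (A : Matrix ι ι ℂ) : ‖A‖ ^ 2 = ∑ i, ∑ j, ‖A i j‖ ^ 2 := by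
  rw [frobenius_norm_def, ← Real.sqrt_eq_rpow, Real.sq_sqrt (by positivity)]
  simp

theorem frobenius_norm_sq_eq_trace (A : Matrix ι ι ℂ) : ((‖A‖ ^ 2 : ℝ) : ℂ) = (Aᴴ * A).trace := by
  rw [frobenius_norm_sq, Finset.sum_comm]
  simp only [Matrix.trace, Matrix.diag, Matrix.mul_apply, conjTranspose_apply, Complex.ofReal_sum]
  refine Finset.sum_congr rfl fun i _ => Finset.sum_congr rfl fun j _ => ?_
  rw [Complex.ofReal_pow, ← Complex.conj_mul']
  rfl

/-- Cauchy–Schwarz for the Hilbert–Schmidt inner product. -/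
theorem norm_trace_conjTranspose_mul_le (A B : Matrix ι ι ℂ) : ‖(Aᴴ * B).trace‖ ≤ ‖A‖ * ‖B‖ := by
  have h1 : ‖(Aᴴ * B).trace‖ ≤ ∑ p : ι × ι, ‖A p.1 p.2‖ * ‖B p.1 p.2‖ := by
    rw [Fintype.sum_prod_type_right]
    simp only [Matrix.trace, Matrix.diag, Matrix.mul_apply, conjTranspose_apply]
    refine (norm_sum_le _ _).trans (Finset.sum_le_sum fun i _ => (norm_sum_le _ _).trans
      (Finset.sum_le_sum fun j _ => ?_))
    simp
  refine h1.trans ?_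
  refine abs_le_of_sq_le_sq' ?_ (by positivity) |>.2
  rw [mul_pow, frobenius_norm_sq, frobenius_norm_sq, ← Fintype.sum_prod_type',
    ← Fintype.sum_prod_type']
  exact Finset.sum_mul_sq_le_sq_mul_sq _ _ _

variable [DecidableEq ι]

theorem norm_mul_of_isometry {U : Matrix ι ι ℂ} (hU : Uᴴ * U = 1) (A : Matrix ι ι ℂ) :
    ‖U * A‖ = ‖A‖ := by
  have h : ‖U * A‖ ^ 2 = ‖A‖ ^ 2 := by
    have : ((‖U * A‖ ^ 2 : ℝ) : ℂ) = ((‖A‖ ^ 2 : ℝ) : ℂ) := by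
      rw [frobenius_norm_sq_eq_trace, frobenius_norm_sq_eq_trace, conjTranspose_mul, mul_assoc,
        ← mul_assoc Uᴴ, hU, one_mul]
    exact_mod_cast this
  exact (sq_eq_sq₀ (norm_nonneg _) (norm_nonneg _)).1 h

theorem norm_mul_of_coisometry {U : Matrix ι ι ℂ} (hU : U * Uᴴ = 1) (A : Matrix ι ι ℂ) :
    ‖A * U‖ = ‖A‖ := by
  rw [← frobenius_norm_conjTranspose (A * U), conjTranspose_mul,
    norm_mul_of_isometry (by rwa [conjTranspose_conjTranspose]), frobenius_norm_conjTranspose]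

theorem norm_sq_add_norm_sq_of_proj {N : Matrix ι ι ℂ} (hN : Nᴴ = N) (hN2 : N * N = N)
    (A : Matrix ι ι ℂ) : ‖N * A‖ ^ 2 + ‖(1 - N) * A‖ ^ 2 = ‖A‖ ^ 2 := by
  have : ((‖N * A‖ ^ 2 + ‖(1 - N) * A‖ ^ 2 : ℝ) : ℂ) = ((‖A‖ ^ 2 : ℝ) : ℂ) := by
    rw [Complex.ofReal_add]
    simp only [frobenius_norm_sq_eq_trace, conjTranspose_mul, conjTranspose_sub, conjTranspose_one,
      hN, ← trace_add]
    congr 1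
    have : (1 - N) * (1 - N) = 1 - N := by noncomm_ring [hN2]
    rw [mul_assoc, mul_assoc, ← mul_assoc N, ← mul_assoc (1 - N), this, hN2, ← mul_add,
      sub_mul, one_mul, add_sub_cancel]
  exact_mod_cast this

theorem norm_proj_mul_le {N : Matrix ι ι ℂ} (hN : Nᴴ = N) (hN2 : N * N = N)
    (A : Matrix ι ι ℂ) : ‖N * A‖ ≤ ‖A‖ ∧ ‖(1 - N) * A‖ ≤ ‖A‖ := by
  have := norm_sq_add_norm_sq_of_proj hN hN2 A
  constructor <;> refine abs_le_of_sq_le_sq' ?_ (norm_nonneg _) |>.2 <;> nlinarith [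
    sq_nonneg ‖N * A‖, sq_nonneg ‖(1 - N) * A‖]

theorem exists_diagonalization {H : Matrix ι ι ℂ} (hH : Hᴴ = H) :
    ∃ (U : Matrix ι ι ℂ) (e : ι → ℝ), Uᴴ * U = 1 ∧ U * Uᴴ = 1 ∧
      H = U * diagonal (fun i => (e i : ℂ)) * Uᴴ := by
  have h : H.IsHermitian := hH
  refine ⟨h.eigenvectorUnitary, h.eigenvalues, ?_, ?_, ?_⟩
  · exact Unitary.coe_star_mul_self h.eigenvectorUnitary
  · exact Unitary.coe_mul_star_self h.eigenvectorUnitary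
  · exact h.spectral_theorem

/-- Spectral projection of a Hermitian matrix onto the eigenvalues of modulus exceeding `t`. -/
theorem exists_spectral_projection {X : Matrix ι ι ℂ} (hX : Xᴴ = X) {t : ℝ} (ht : 0 ≤ t) :
    ∃ N : Matrix ι ι ℂ, Nᴴ = N ∧ N * N = N ∧ (∀ M, ‖X * ((1 - N) * M)‖ ≤ t * ‖M‖) ∧
      ∀ M, t * ‖N * M‖ ≤ ‖X * M‖ := by
  obtain ⟨U, e, hU, hU', rfl⟩ := exists_diagonalization hX
  have hUs : Uᴴᴴ * Uᴴ = 1 := by rwa [conjTranspose_conjTranspose]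
  set c : ι → ℂ := fun i => if t < |e i| then 1 else 0 with hc
  refine ⟨U * diagonal c * Uᴴ, ?_, ?_, fun M => ?_, fun M => ?_⟩
  · have : star c = c := by ext i; simp only [hc, Pi.star_apply]; split_ifs <;> simp
    simp only [conjTranspose_mul, conjTranspose_conjTranspose, diagonal_conjTranspose, this,
      mul_assoc]
  · calc U * diagonal c * Uᴴ * (U * diagonal c * Uᴴ)
        = U * (diagonal c * (Uᴴ * U) * diagonal c) * Uᴴ := by simp only [mul_assoc]
      _ = U * diagonal c * Uᴴ := by
        rw [hU, mul_one, diagonal_mul_diagonal]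
        congr 3
        ext i; simp only [hc]; split_ifs <;> simp
  · have h1 : U * diagonal (fun i => (e i : ℂ)) * Uᴴ * ((1 - U * diagonal c * Uᴴ) * M) =
        U * (diagonal (fun i => (e i : ℂ) * (1 - c i)) * (Uᴴ * M)) := by
      have : diagonal (fun i => (e i : ℂ) * (1 - c i)) =
          diagonal (fun i => (e i : ℂ)) * (1 - diagonal c) := by
        rw [← diagonal_one, diagonal_sub, diagonal_mul_diagonal]
      rw [this]
      calc _ = U * (diagonal (fun i => (e i : ℂ)) * (Uᴴ * M - (Uᴴ * U) * diagonal c * Uᴴ * M)) := by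
            simp only [mul_assoc, sub_mul, mul_sub, one_mul]
        _ = _ := by rw [hU]; simp only [mul_assoc, sub_mul, mul_sub, one_mul]
    rw [h1, norm_mul_of_isometry hU, ← norm_mul_of_isometry hUs M]
    refine abs_le_of_sq_le_sq' ?_ (by positivity) |>.2
    rw [mul_pow, frobenius_norm_sq, frobenius_norm_sq, Finset.mul_sum]
    refine Finset.sum_le_sum fun i _ => ?_
    rw [Finset.mul_sum]
    refine Finset.sum_le_sum fun j _ => ?_
    rw [diagonal_mul, norm_mul, mul_pow]
    refine mul_le_mul_of_nonneg_right (pow_le_pow_left₀ (norm_nonneg _) ?_ 2) (by positivity)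
    simp only [hc]
    split_ifs with h
    · simpa using ht
    · simpa using not_lt.1 h
  · rw [mul_assoc, mul_assoc, mul_assoc, mul_assoc, norm_mul_of_isometry hU,
      norm_mul_of_isometry hU]
    refine abs_le_of_sq_le_sq' ?_ (by positivity) |>.2
    rw [mul_pow, frobenius_norm_sq, frobenius_norm_sq, Finset.mul_sum]
    refine Finset.sum_le_sum fun i _ => ?_
    rw [Finset.mul_sum]
    refine Finset.sum_le_sum fun j _ => ?_
    rw [diagonal_mul, diagonal_mul, norm_mul, norm_mul, mul_pow, mul_pow, ← mul_assoc]
    refine mul_le_mul_of_nonneg_right ?_ (by positivity)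
    rw [← mul_pow]
    refine pow_le_pow_left₀ (by positivity) ?_ 2
    simp only [hc]
    split_ifs with h
    · simpa using h.le
    · simp

/-- If `v` and `P w` are concentrated on the small spectral values of `X`, then `X - P X P` has a
small matrix element between them. -/
theorem norm_trace_sub_conj_le {X P N Z v w : Matrix ι ι ℂ} {t α b : ℝ} (hX : Xᴴ = X)
    (hP : Pᴴ = P) (hP2 : P * P = 1) (hN : Nᴴ = N) (hN2 : N * N = N) (hZ : Z = X - P * X * P)
    (ht : 0 ≤ t) (hXN : ∀ M, ‖X * ((1 - N) * M)‖ ≤ t * ‖M‖) (hb : 0 ≤ b)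
    (hZb : ∀ M, ‖Z * M‖ ≤ b * ‖M‖)
    (hv : ‖v‖ = 1) (hw : ‖w‖ = 1) (hNv : ‖N * v‖ ≤ α) (hNw : ‖N * (P * w)‖ ≤ α) :
    ‖(wᴴ * (Z * v)).trace‖ ≤ 2 * b * α + 2 * t := by
  have hPi : Pᴴ * P = 1 := by rw [hP, hP2]
  set v₁ := N * v
  set v₂ := (1 - N) * v with hv₂
  set w₁ := P * (N * (P * w))
  set w₂ := P * ((1 - N) * (P * w)) with hw₂
  have hvs : v = v₁ + v₂ := by simp [v₁, v₂, sub_mul]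
  have hws : w = w₁ + w₂ := by
    simp only [w₁, w₂, ← mul_add, ← add_mul, add_sub_cancel, one_mul]
    rw [← mul_assoc, hP2, one_mul]
  have hv₂n : ‖v₂‖ ≤ 1 := hv ▸ (norm_proj_mul_le hN hN2 v).2
  have hPw : ‖P * w‖ = 1 := by rw [norm_mul_of_isometry hPi, hw]
  have hw₁n : ‖w₁‖ ≤ α := by rwa [norm_mul_of_isometry hPi]
  have hw₂n : ‖w₂‖ ≤ 1 := by
    rw [hw₂, norm_mul_of_isometry hPi]; exact hPw ▸ (norm_proj_mul_le hN hN2 _).2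
  have hα : 0 ≤ α := (norm_nonneg _).trans hNv
  -- The pieces in the range of N are small, and there the bound b on Z is enough. On the remaining
  -- pair Z is split back into X and PXP, and each of these acts on a vector with small spectral
  -- values.
  have e1 : (wᴴ * (Z * v)).trace = (wᴴ * (Z * v₁)).trace + (w₁ᴴ * (Z * v₂)).trace +
      ((w₂ᴴ * (X * v₂)).trace - ((X * (P * w₂))ᴴ * (P * v₂)).trace) := by
    have : (X * (P * w₂))ᴴ * (P * v₂) = w₂ᴴ * (P * X * P * v₂) := by
      simp only [conjTranspose_mul, hX, hP, mul_assoc]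
    rw [this, ← trace_sub, ← mul_sub, ← sub_mul, ← hZ, ← trace_add, ← trace_add, hvs]
    congr 1
    conv_lhs => rw [mul_add Z, mul_add]
    rw [add_assoc, ← add_mul, ← conjTranspose_add, ← hws]
  have b1 : ‖(wᴴ * (Z * v₁)).trace‖ ≤ b * α := by
    refine (norm_trace_conjTranspose_mul_le _ _).trans ?_
    rw [hw, one_mul]
    exact (hZb _).trans (mul_le_mul_of_nonneg_left hNv hb)
  have b2 : ‖(w₁ᴴ * (Z * v₂)).trace‖ ≤ b * α := by
    refine (norm_trace_conjTranspose_mul_le _ _).trans ?_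
    rw [mul_comm b]
    refine mul_le_mul hw₁n ((hZb _).trans ?_) (norm_nonneg _) hα
    exact mul_le_of_le_one_right hb hv₂n
  have b3 : ‖(w₂ᴴ * (X * v₂)).trace‖ ≤ t := by
    refine (norm_trace_conjTranspose_mul_le _ _).trans ?_
    have := hXN v
    rw [hv, mul_one] at this
    calc _ ≤ 1 * t := mul_le_mul hw₂n this (norm_nonneg _) zero_le_one
      _ = t := one_mul t
  have b4 : ‖((X * (P * w₂))ᴴ * (P * v₂)).trace‖ ≤ t := by
    refine (norm_trace_conjTranspose_mul_le _ _).trans ?_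
    rw [norm_mul_of_isometry hPi]
    have : X * (P * w₂) = X * ((1 - N) * (P * w)) := by
      rw [hw₂, ← mul_assoc P P, hP2, one_mul]
    have h2 := hXN (P * w)
    rw [hPw, mul_one, ← this] at h2
    calc _ ≤ t * 1 := mul_le_mul h2 hv₂n (norm_nonneg _) ht
      _ = t := mul_one t
  rw [e1]
  have := norm_add_le ((wᴴ * (Z * v₁)).trace + (w₁ᴴ * (Z * v₂)).trace)
    ((w₂ᴴ * (X * v₂)).trace - ((X * (P * w₂))ᴴ * (P * v₂)).trace)
  have := norm_add_le (wᴴ * (Z * v₁)).trace (w₁ᴴ * (Z * v₂)).trace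
  have := norm_sub_le (w₂ᴴ * (X * v₂)).trace ((X * (P * w₂))ᴴ * (P * v₂)).trace
  linarith

end Frobenius

/-! ### Gibbs states in an eigenbasis of the Hamiltonian -/

section Gibbs

open scoped Matrix.Norms.Frobenius

variable {ι : Type*} [Fintype ι] [DecidableEq ι]

/-- `U` diagonalizes `H` with energies `e`, and `r` are the Gibbs weights at inverse temperature
`β`. -/
structure GibbsBasis (β : ℝ) (H U : Matrix ι ι ℂ) (e r : ι → ℝ) : Prop where
  left : Uᴴ * U = 1
  right : U * Uᴴ = 1
  diag : H = U * diagonal (fun i => (e i : ℂ)) * Uᴴ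
  pos : ∀ i, 0 < r i
  sum : ∑ i, r i = 1
  ratio : ∀ i j, r j = r i * Real.exp (β * (e i - e j))

/-- A square root of the Gibbs state, written in an eigenbasis on the right. -/
def gibbsRoot (U : Matrix ι ι ℂ) (r : ι → ℝ) : Matrix ι ι ℂ :=
  U * diagonal fun i => ((√(r i) : ℝ) : ℂ)

namespace GibbsBasis

variable {β : ℝ} {H U : Matrix ι ι ℂ} {e r : ι → ℝ}

theorem norm_root (hG : GibbsBasis β H U e r) : ‖gibbsRoot U r‖ = 1 := by
  have : ‖gibbsRoot U r‖ ^ 2 = 1 := by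
    rw [gibbsRoot, norm_mul_of_isometry hG.left, frobenius_norm_sq, ← hG.sum]
    refine Finset.sum_congr rfl fun i _ => ?_
    rw [Finset.sum_eq_single i]
    · rw [diagonal_apply_eq, Complex.norm_real, Real.norm_eq_abs, sq_abs,
        Real.sq_sqrt (hG.pos i).le]
    · intro j _ hj
      simp [diagonal_apply_ne' _ hj]
    · simp
  exact (pow_eq_one_iff_of_nonneg (norm_nonneg _) two_ne_zero).1 this

/-- Conjugating a Gibbs state by an operator that changes the energy only a little increases the
probability of a rare event by a bounded factor, up to a small error. -/
theorem norm_sq_proj_mul_le (hG : GibbsBasis β H U e r) (hβ : 0 ≤ β) {N W : Matrix ι ι ℂ}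
    (hN : Nᴴ = N) (hN2 : N * N = N) (hW : Wᴴ * W = 1) (hW' : W * Wᴴ = 1) {h s Δ : ℝ}
    (hh : ‖(H * W - W * H) * gibbsRoot U r‖ ≤ h) (hs : 0 < s) (hΔ : 0 < Δ) :
    ‖N * (W * gibbsRoot U r)‖ ^ 2 ≤
      s + h ^ 2 / Δ ^ 2 + (1 + 1 / s) * Real.exp (β * Δ) * ‖N * gibbsRoot U r‖ ^ 2 := by
  have hUs : Uᴴᴴ * Uᴴ = 1 := by rw [conjTranspose_conjTranspose, hG.right]
  set V := gibbsRoot U r with hV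
  set A := Uᴴ * ((1 - N) * (W * V)) with hA
  set G := Uᴴ * (N * (W * U)) with hGm
  set C := Uᴴ * (W * V) with hC
  -- In the energy basis, WV splits into its part outside the rare event and its part inside; the
  -- latter carries the weight √(r j) in column j.
  have hCAB : C = A + G * diagonal fun i => ((√(r i) : ℝ) : ℂ) := by
    rw [hA, hGm, hC, hV, gibbsRoot]
    simp only [mul_assoc, sub_mul, mul_sub, one_mul, sub_add_cancel]
  have hHV : H * V = V * diagonal fun i => (e i : ℂ) := by
    rw [hG.diag, hV, gibbsRoot, mul_assoc, mul_assoc, ← mul_assoc Uᴴ, hG.left, one_mul,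
      diagonal_mul_diagonal, mul_assoc, diagonal_mul_diagonal]
    simp only [mul_comm]
  have hUH : Uᴴ * H = diagonal (fun i => (e i : ℂ)) * Uᴴ := by
    rw [hG.diag, ← mul_assoc, ← mul_assoc, hG.left, one_mul]
  have hcomm : Uᴴ * ((H * W - W * H) * V) =
      diagonal (fun i => (e i : ℂ)) * C - C * diagonal fun i => (e i : ℂ) := by
    rw [sub_mul, mul_sub, mul_assoc, mul_assoc, ← mul_assoc Uᴴ H, hUH, hHV, hC]
    simp only [mul_assoc]
  have f1 : ∑ i, ∑ j, (e i - e j) ^ 2 * ‖C i j‖ ^ 2 ≤ h ^ 2 := by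
    rw [← norm_mul_of_isometry hUs, hcomm] at hh
    refine le_trans (le_of_eq ?_) (pow_le_pow_left₀ (norm_nonneg _) hh 2)
    rw [frobenius_norm_sq]
    refine Finset.sum_congr rfl fun i _ => Finset.sum_congr rfl fun j _ => ?_
    rw [Matrix.sub_apply, diagonal_mul, mul_diagonal, mul_comm (C i j), ← sub_mul, norm_mul,
      mul_pow, ← Complex.ofReal_sub, Complex.norm_real, Real.norm_eq_abs, sq_abs]
  have f2 : ∑ i, ∑ j, r i * ‖G i j‖ ^ 2 = ‖N * V‖ ^ 2 := by
    have : ‖(diagonal fun i => ((√(r i) : ℝ) : ℂ)) * G‖ = ‖N * V‖ := by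
      have h1 : (diagonal fun i => ((√(r i) : ℝ) : ℂ)) * G = (N * V)ᴴ * W * U := by
        have : star (fun i => ((√(r i) : ℝ) : ℂ)) = fun i => ((√(r i) : ℝ) : ℂ) := by
          ext i; simp
        rw [hGm, hV, gibbsRoot]
        simp only [conjTranspose_mul, hN, diagonal_conjTranspose, mul_assoc, this]
      rw [h1, norm_mul_of_coisometry hG.right, norm_mul_of_coisometry hW',
        frobenius_norm_conjTranspose]
    rw [← this, frobenius_norm_sq]
    refine Finset.sum_congr rfl fun i _ => Finset.sum_congr rfl fun j _ => ?_
    rw [diagonal_mul, norm_mul, mul_pow, Complex.norm_real, Real.norm_eq_abs, sq_abs,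
      Real.sq_sqrt (hG.pos i).le]
  have f3 : ∑ i, ∑ j, ‖C i j‖ ^ 2 = 1 := by
    rw [← frobenius_norm_sq, hC, norm_mul_of_isometry hUs, norm_mul_of_isometry hW, hV,
      hG.norm_root, one_pow]
  have f4 : ∑ i, ∑ j, ‖A i j‖ ^ 2 = 1 - ‖N * (W * V)‖ ^ 2 := by
    rw [← frobenius_norm_sq, hA, norm_mul_of_isometry hUs]
    have := norm_sq_add_norm_sq_of_proj hN hN2 (W * V)
    rw [norm_mul_of_isometry hW, hV, hG.norm_root] at this
    linarith
  have key : ∀ i j, ‖C i j‖ ^ 2 ≤ (1 + s) * ‖A i j‖ ^ 2 +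
      (1 + 1 / s) * Real.exp (β * Δ) * (r i * ‖G i j‖ ^ 2) +
      1 / Δ ^ 2 * ((e i - e j) ^ 2 * ‖C i j‖ ^ 2) := by
    intro i j
    have p1 : 0 ≤ (1 + s) * ‖A i j‖ ^ 2 := by positivity
    have p2 : 0 ≤ (1 + 1 / s) * Real.exp (β * Δ) * (r i * ‖G i j‖ ^ 2) := by
      have := hG.pos i
      positivity
    have p3 : 0 ≤ 1 / Δ ^ 2 * ((e i - e j) ^ 2 * ‖C i j‖ ^ 2) := by positivity
    -- For close energies the weight r j can be exchanged for r i at the cost exp (β * Δ), and the r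
    -- i-weighted sum is ‖N * V‖². Distant energies are controlled by the commutator bound, as in
    -- Chebyshev's inequality.
    by_cases hn : |e i - e j| ≤ Δ
    · have hB : ‖G i j * ((√(r j) : ℝ) : ℂ)‖ ^ 2 ≤ Real.exp (β * Δ) * (r i * ‖G i j‖ ^ 2) := by
        rw [norm_mul, mul_pow, Complex.norm_real, Real.norm_eq_abs, sq_abs,
          Real.sq_sqrt (hG.pos j).le, hG.ratio i j]
        have : Real.exp (β * (e i - e j)) ≤ Real.exp (β * Δ) :=
          Real.exp_le_exp.2 (mul_le_mul_of_nonneg_left ((le_abs_self _).trans hn) hβ)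
        have h0 : 0 ≤ ‖G i j‖ ^ 2 * r i := mul_nonneg (by positivity) (hG.pos i).le
        nlinarith [mul_le_mul_of_nonneg_left this h0]
      have hC2 : ‖C i j‖ ≤ ‖A i j‖ + ‖G i j * ((√(r j) : ℝ) : ℂ)‖ := by
        rw [hCAB, Matrix.add_apply, mul_diagonal]
        exact norm_add_le _ _
      set x := ‖A i j‖
      set y := ‖G i j * ((√(r j) : ℝ) : ℂ)‖
      have hxy : (x + y) ^ 2 ≤ (1 + s) * x ^ 2 + (1 + 1 / s) * y ^ 2 := by
        have : (1 + s) * x ^ 2 + (1 + 1 / s) * y ^ 2 - (x + y) ^ 2 = (s * x - y) ^ 2 / s := by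
          field_simp; ring
        have : 0 ≤ (s * x - y) ^ 2 / s := by positivity
        linarith
      have h1 := pow_le_pow_left₀ (norm_nonneg _) hC2 2
      have h2 := mul_le_mul_of_nonneg_left hB (show (0 : ℝ) ≤ 1 + 1 / s by positivity)
      rw [← mul_assoc] at h2
      linarith
    · have h1 : Δ ^ 2 ≤ (e i - e j) ^ 2 := by
        rw [← sq_abs (e i - e j)]
        exact pow_le_pow_left₀ hΔ.le (not_le.1 hn).le 2
      have h2 : ‖C i j‖ ^ 2 ≤ 1 / Δ ^ 2 * ((e i - e j) ^ 2 * ‖C i j‖ ^ 2) := by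
        rw [← mul_assoc, one_div, ← div_eq_inv_mul]
        exact le_mul_of_one_le_left (by positivity) ((one_le_div (by positivity)).2 h1)
      linarith
  have total := Finset.sum_le_sum fun i (_ : i ∈ Finset.univ) =>
    Finset.sum_le_sum fun j (_ : j ∈ Finset.univ) => key i j
  simp only [Finset.sum_add_distrib, ← Finset.mul_sum] at total f2
  -- The total mass 1 is now at most (1 + s)(1 - ‖N W V‖²) plus the two error terms; solving for ‖N
  -- W V‖² gives the claim.
  rw [f2, f3, f4] at total
  have h1 : 1 / Δ ^ 2 * ∑ i, ∑ j, (e i - e j) ^ 2 * ‖C i j‖ ^ 2 ≤ h ^ 2 / Δ ^ 2 := by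
    rw [div_mul_eq_mul_div, one_mul]
    gcongr
  have h2 : 0 ≤ s * ‖N * (W * V)‖ ^ 2 := by positivity
  nlinarith

/-- `1 - exp (-2 y) ≥ (1 + exp (-2 y)) y / (1 + y)`, in the form comparing the logarithmic and the
arithmetic mean of two Gibbs weights. -/
theorem mean_ineq {β M x u v : ℝ} (hβ : 0 ≤ β) (hx : |x| ≤ 2 * M) (hu : 0 < u)
    (hv : v = u * Real.exp (-(β * x))) :
    β * (x ^ 2 * ((u + v) / 2)) ≤ (1 + β * M) * (x * (u - v)) := by
  -- Both sides are invariant under exchanging u and v while changing the sign of x.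
  wlog h0 : 0 ≤ x generalizing x u v
  · have := @this (-x) v u (by rwa [abs_neg]) (by rw [hv]; positivity)
      (by rw [hv, mul_assoc, ← Real.exp_add]; simp) (by linarith)
    linarith [this]
  rw [abs_of_nonneg h0] at hx
  set E := Real.exp (-(β * x)) with hE
  have hE1 : E * (1 + β * x) ≤ 1 := by
    have h1 := Real.add_one_le_exp (β * x)
    have h2 : E * Real.exp (β * x) = 1 := by rw [hE, ← Real.exp_add]; simp
    have h3 : 0 < E := Real.exp_pos _
    nlinarith
  have hE2 : E ≤ 1 := Real.exp_le_one_iff.2 (by have := mul_nonneg hβ h0; linarith)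
  -- After expansion this is exactly `hE1`.
  have h4 : β * x / 2 * (1 + E) ≤ (1 + β * x / 2) * (1 - E) := by linarith
  have h5 : (1 + β * x / 2) * (1 - E) ≤ (1 + β * M) * (1 - E) := by
    have := mul_le_mul_of_nonneg_left hx hβ
    exact mul_le_mul_of_nonneg_right (by linarith) (by linarith)
  have h6 := mul_le_mul_of_nonneg_left (h4.trans h5) (mul_nonneg hu.le h0)
  rw [hv]
  linarith

/-- Entropy-production bound: if `H'` almost commutes with the Gibbs state when tested against
`X = i[H, H']`, then `X` is small in the Gibbs state. -/
theorem norm_sq_comm_le (hG : GibbsBasis β H U e r) (hβ : 0 ≤ β) {M : ℝ}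
    (hM : ∀ i, |e i| ≤ M) {H' X ρ : Matrix ι ι ℂ} (hH' : H'ᴴ = H')
    (hX : X = Complex.I • (H * H' - H' * H)) (hρ : ρ = U * diagonal (fun i => (r i : ℂ)) * Uᴴ) :
    β * ‖X * gibbsRoot U r‖ ^ 2 ≤
      (1 + β * M) * (Complex.I * (X * (H' * ρ - ρ * H')).trace).re := by
  have hUs : Uᴴᴴ * Uᴴ = 1 := by rw [conjTranspose_conjTranspose, hG.right]
  set g := Uᴴ * H' * U with hg
  have hgs : ∀ i j, ‖g i j‖ = ‖g j i‖ := by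
    have : gᴴ = g := by simp only [hg, conjTranspose_mul, conjTranspose_conjTranspose, hH', mul_assoc]
    intro i j
    conv_lhs => rw [← this, conjTranspose_apply, norm_star]
  have cancel : ∀ B : Matrix ι ι ℂ, Uᴴ * (U * B) = B := fun B => by
    rw [← mul_assoc, hG.left, one_mul]
  have hH'g : H' = U * g * Uᴴ := by
    rw [hg, ← mul_assoc, ← mul_assoc, hG.right, one_mul, mul_assoc, hG.right, mul_one]
  -- The matrix of X in the eigenbasis: commuting with H multiplies each entry of H' by an energy
  -- difference.
  set x : Matrix ι ι ℂ := Matrix.of fun i j => Complex.I * ((e i - e j : ℝ) : ℂ) * g i j with hx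
  have hXx : X = U * x * Uᴴ := by
    have hxe : x = Complex.I • (diagonal (fun i => (e i : ℂ)) * g -
        g * diagonal fun i => (e i : ℂ)) := by
      ext i j
      simp only [hx, of_apply, Matrix.smul_apply, Matrix.sub_apply, diagonal_mul, mul_diagonal, smul_eq_mul,
        Complex.ofReal_sub]
      ring
    rw [hX, hH'g, hG.diag, hxe]
    simp only [mul_assoc, cancel, mul_sub, sub_mul, mul_smul_comm, smul_mul_assoc, smul_sub]
  have hnorm : ‖X * gibbsRoot U r‖ ^ 2 = ∑ i, ∑ j, (e i - e j) ^ 2 * ‖g i j‖ ^ 2 * r j := by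
    rw [hXx, gibbsRoot, mul_assoc, mul_assoc, cancel, norm_mul_of_isometry hG.left,
      frobenius_norm_sq]
    refine Finset.sum_congr rfl fun i _ => Finset.sum_congr rfl fun j _ => ?_
    rw [mul_diagonal, norm_mul, mul_pow, hx, of_apply, norm_mul, norm_mul, Complex.norm_I, one_mul,
      Complex.norm_real, Complex.norm_real, Real.norm_eq_abs, Real.norm_eq_abs, mul_pow, sq_abs,
      sq_abs, Real.sq_sqrt (hG.pos j).le]
  -- Since |g i j| = |g j i|, the weight r j can be replaced by its mean with r i, the form needed
  -- for `mean_ineq`.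
  have hnorm' : ‖X * gibbsRoot U r‖ ^ 2 =
      ∑ i, ∑ j, ‖g i j‖ ^ 2 * ((e i - e j) ^ 2 * ((r j + r i) / 2)) := by
    have h2 : ‖X * gibbsRoot U r‖ ^ 2 = ∑ i, ∑ j, (e i - e j) ^ 2 * ‖g i j‖ ^ 2 * r i := by
      rw [hnorm, Finset.sum_comm]
      refine Finset.sum_congr rfl fun i _ => Finset.sum_congr rfl fun j _ => ?_
      rw [hgs j i]; ring
    have h3 : ‖X * gibbsRoot U r‖ ^ 2 =
        (‖X * gibbsRoot U r‖ ^ 2 + ‖X * gibbsRoot U r‖ ^ 2) / 2 := by ring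
    rw [h3]
    conv_lhs => rw [hnorm]
    rw [← hnorm, h2]
    conv_lhs => enter [1, 1]; rw [← h2, hnorm]
    simp only [← Finset.sum_add_distrib, Finset.sum_div]
    refine Finset.sum_congr rfl fun i _ => Finset.sum_congr rfl fun j _ => ?_
    ring
  have htr : (Complex.I * (X * (H' * ρ - ρ * H')).trace).re =
      ∑ i, ∑ j, ‖g i j‖ ^ 2 * ((e i - e j) * (r j - r i)) := by
    have h1 : X * (H' * ρ - ρ * H') = U * (x * (g * diagonal (fun i => (r i : ℂ)) -
        diagonal (fun i => (r i : ℂ)) * g)) * Uᴴ := by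
      rw [hXx, hH'g, hρ]
      simp only [mul_assoc, cancel, mul_sub, sub_mul]
    rw [h1, trace_mul_comm, ← mul_assoc, hG.left, one_mul]
    have h2 : Complex.I * (x * (g * diagonal (fun i => (r i : ℂ)) -
        diagonal (fun i => (r i : ℂ)) * g)).trace =
        ((∑ i, ∑ j, ‖g i j‖ ^ 2 * ((e i - e j) * (r j - r i)) : ℝ) : ℂ) := by
      simp only [Matrix.trace, diag_apply, Matrix.mul_apply, Finset.mul_sum, Complex.ofReal_sum]
      refine Finset.sum_congr rfl fun i _ => Finset.sum_congr rfl fun j _ => ?_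
      have h3 : g j i = star (g i j) := by
        have : gᴴ = g := by
          simp only [hg, conjTranspose_mul, conjTranspose_conjTranspose, hH', mul_assoc]
        rw [← conjTranspose_apply, this]
      have h4 : g i j * star (g i j) = ((‖g i j‖ ^ 2 : ℝ) : ℂ) := by
        rw [Complex.ofReal_pow]; exact Complex.mul_conj' _
      have h5 : x i j * ((g * diagonal fun i => (r i : ℂ)) - (diagonal fun i => (r i : ℂ)) * g) j i
          = Complex.I * ((e i - e j : ℝ) : ℂ) * (g i j * star (g i j)) * ((r i : ℂ) - r j) := by
        rw [Matrix.sub_apply, diagonal_mul, mul_diagonal, h3, hx, of_apply]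
        ring
      simp only [Matrix.mul_apply, Matrix.sub_apply] at h5
      rw [Matrix.sub_apply, Matrix.mul_apply, Matrix.mul_apply, h5, h4]
      push_cast
      linear_combination ((e i : ℂ) - e j) * (‖g i j‖ : ℂ) ^ 2 * ((r i : ℂ) - r j) * Complex.I_sq
    rw [h2, Complex.ofReal_re]
  rw [hnorm', htr]
  simp only [Finset.mul_sum]
  refine Finset.sum_le_sum fun i _ => Finset.sum_le_sum fun j _ => ?_
  have := mean_ineq hβ (x := e i - e j) (M := M) (u := r j) (v := r i)
    ((abs_sub _ _).trans (by linarith [hM i, hM j])) (hG.pos j)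
    (by rw [hG.ratio j i]; congr 2; ring)
  have h2 := mul_le_mul_of_nonneg_left this (sq_nonneg ‖g i j‖)
  linarith

end GibbsBasis

theorem exists_gibbsBasis {n : ℕ} (β : ℝ) {H : Op n} (hH : Hᴴ = H) :
    ∃ (U : Op n) (e r : (Fin n → Fin 2) → ℝ), GibbsBasis β H U e r ∧
      gibbs β H = U * diagonal (fun i => (r i : ℂ)) * Uᴴ := by
  obtain ⟨U, e, hU, hU', hd⟩ := exists_diagonalization hH
  have hinv : U⁻¹ = Uᴴ := inv_eq_left_inv hU
  have hexp : NormedSpace.exp (-(β : ℂ) • H) =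
      U * diagonal (fun i => ((Real.exp (-β * e i) : ℝ) : ℂ)) * Uᴴ := by
    have h1 : -(β : ℂ) • H = U * diagonal (fun i => ((-β * e i : ℝ) : ℂ)) * U⁻¹ := by
      rw [hinv]
      have : (diagonal fun i => ((-β * e i : ℝ) : ℂ)) = -(β : ℂ) • diagonal fun i => (e i : ℂ) := by
        ext i j; by_cases h : i = j <;> simp [h]
      rw [this, mul_smul_comm, smul_mul_assoc, ← hd]
    rw [h1, Matrix.exp_conj _ _ (IsUnit.of_mul_eq_one _ hU'), hinv, Matrix.exp_diagonal]
    congr 3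
    ext i
    rw [Pi.coe_exp, ← Complex.exp_eq_exp_ℂ, Complex.ofReal_exp]
  set Z := ∑ i, Real.exp (-β * e i) with hZ
  have hZpos : 0 < Z := Finset.sum_pos (fun i _ => Real.exp_pos _) Finset.univ_nonempty
  have htr : (NormedSpace.exp (-(β : ℂ) • H)).trace = (Z : ℂ) := by
    rw [hexp, trace_mul_comm, ← mul_assoc, hU, one_mul, trace_diagonal, hZ, Complex.ofReal_sum]
  refine ⟨U, e, fun i => Real.exp (-β * e i) / Z, ⟨hU, hU', hd, fun i => by positivity, ?_, ?_⟩, ?_⟩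
  · rw [← Finset.sum_div, div_self hZpos.ne']
  · intro i j
    rw [div_mul_eq_mul_div, ← Real.exp_add]
    congr 2; ring
  · rw [gibbs, htr, hexp, ← smul_mul_assoc, ← mul_smul_comm]
    congr 2
    ext i j
    by_cases h : i = j <;> simp [h, div_eq_inv_mul]

end Gibbs

/-! ### A lower bound on the variance of a sum of local Pauli strings -/

section Variance

open scoped Matrix.Norms.Frobenius

namespace PauliString

variable {n : ℕ}

theorem op_isometry (P : PauliString n) : P.opᴴ * P.op = 1 := by
  rw [conjTranspose_op, op_mul_self]

theorem op_coisometry (P : PauliString n) : P.op * P.opᴴ = 1 := by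
  rw [conjTranspose_op, op_mul_self]

theorem norm_op_mul (P : PauliString n) (M : Op n) : ‖P.op * M‖ = ‖M‖ :=
  norm_mul_of_isometry P.op_isometry M

/-- A competitor of F that survives the signed average over `F.supp` acts on strictly more qubits.
This is what lets a weight growing with the support size suppress it. -/
theorem supp_ssubset_of_agree {F G : PauliString n} (h : ∀ i ∈ F.supp, F i = G i) (hne : G ≠ F) :
    F.supp ⊂ G.supp := by
  refine Finset.ssubset_iff_subset_ne.2 ⟨fun i hi => ?_, fun he => hne ?_⟩
  · have := hi
    simp only [supp, Finset.mem_filter, Finset.mem_univ, true_and] at this ⊢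
    rwa [← h i hi]
  · funext i
    by_cases hi : i ∈ F.supp
    · exact (h i hi).symm
    · have hi' := he ▸ hi
      simp only [supp, Finset.mem_filter, Finset.mem_univ, true_and, not_not] at hi hi'
      rw [hi, hi']

end PauliString

theorem norm_sum_smul_op_mul_le {n : ℕ} (s : Finset (PauliString n)) (c : PauliString n → ℝ)
    (M : Op n) : ‖(∑ G ∈ s, (c G : ℂ) • G.op) * M‖ ≤ (∑ G ∈ s, |c G|) * ‖M‖ := by
  rw [Finset.sum_mul, Finset.sum_mul]
  refine (norm_sum_le _ _).trans (Finset.sum_le_sum fun G _ => ?_)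
  rw [smul_mul_assoc, norm_smul, G.norm_op_mul, Complex.norm_real, Real.norm_eq_abs]

/-- Conjugation by Q multiplies G by its sign against Q, so by character orthogonality the signed
average keeps exactly the strings that look like F on R. -/
theorem sum_sgn_smul_conj {n : ℕ} (s : Finset (PauliString n)) (c : PauliString n → ℝ)
    (F : PauliString n) (R : Finset (Fin n)) :
    ∑ Q ∈ PauliString.supported R,
      (Q.sgn F : ℂ) • (Q.op * (∑ G ∈ s, (c G : ℂ) • G.op) * Q.op) =
    (4 : ℂ) ^ R.card • ∑ G ∈ s with ∀ i ∈ R, F i = G i, (c G : ℂ) • G.op := by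
  simp only [Finset.mul_sum, Finset.sum_mul, Finset.smul_sum, mul_smul_comm, smul_mul_assoc,
    PauliString.conj_op, Finset.sum_filter]
  rw [Finset.sum_comm]
  refine Finset.sum_congr rfl fun G _ => ?_
  have h1 : ∀ Q : PauliString n, (Q.sgn F : ℂ) • (c G : ℂ) • (Q.sgn G : ℂ) • G.op =
      ((Q.sgn F * Q.sgn G : ℝ) : ℂ) • (c G : ℂ) • G.op := fun Q => by
    rw [smul_comm (c G : ℂ), smul_smul, Complex.ofReal_mul]
  simp only [h1]
  rw [← Finset.sum_smul, ← Complex.ofReal_sum, PauliString.sum_sgn_mul_sgn]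
  split_ifs <;> simp

/-- Variance lower bound: in a Gibbs state, the second moment of a sum of local Pauli strings is at
least `exp (-O(β))` times the square of each coefficient. -/
theorem exists_variance_bound (K N₁ : ℕ) (hN₁ : 0 < N₁) {h : ℝ} (hh : 0 ≤ h) :
    ∃ κ Δ : ℝ, 0 < κ ∧ 0 < Δ ∧ ∀ {n : ℕ} {β : ℝ} {H U : Op n} {e r : (Fin n → Fin 2) → ℝ}
      (𝓕 : Finset (PauliString n)) (γ : PauliString n → ℝ),
      0 ≤ β → GibbsBasis β H U e r →
      (∀ F ∈ 𝓕, F.supp.card ≤ K) →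
      (∀ R : Finset (Fin n), R.card ≤ K → (𝓕.filter fun G => ¬ Disjoint R G.supp).card ≤ N₁) →
      (∀ P : PauliString n, P.supp.card ≤ K →
        ‖(H * P.op - P.op * H) * gibbsRoot U r‖ ≤ h) →
      (∀ F ∈ 𝓕, (F = fun _ => Pauli.I) → γ F = 0) →
      ∀ F ∈ 𝓕, κ * Real.exp (-(β * Δ)) * γ F ^ 2 ≤
        ‖(∑ F ∈ 𝓕, (γ F : ℂ) • F.op) * gibbsRoot U r‖ ^ 2 := by
  have hN₁' : (1 : ℝ) ≤ N₁ := by exact_mod_cast hN₁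
  -- B makes N₁ competitors of size Γ / B sum to Γ / 2, and α makes b * α = Γ / 4 below. With s, Δ
  -- and κ₀, each of the three terms of the leakage bound is at most α² / 3; the 1 added to h keeps
  -- Δ positive.
  set B : ℝ := 2 * N₁ with hB
  have hB1 : 1 ≤ B := by linarith
  have hB0 : 0 < B := by linarith
  set α : ℝ := 1 / (8 * N₁ * B ^ K) with hα
  have hα0 : 0 < α := by positivity
  set s : ℝ := α ^ 2 / 3 with hs
  have hs0 : 0 < s := by positivity
  set Δ : ℝ := (h + 1) * 3 / α with hΔ
  have hΔ0 : 0 < Δ := by positivity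
  set κ₀ : ℝ := α ^ 2 / 3 / (64 * (1 + 1 / s)) with hκ₀
  have hκ₀0 : 0 < κ₀ := by positivity
  refine ⟨κ₀ / (B ^ K) ^ 2, Δ, by positivity, hΔ0, ?_⟩
  intro n β H U e r 𝓕 γ hβ hG hK hcount hcomm hI F hF
  set X : Op n := ∑ F ∈ 𝓕, (γ F : ℂ) • F.op with hX
  set V := gibbsRoot U r with hV
  -- The weight B ^ |supp| favours large supports, so strings properly extending F₀ have
  -- coefficients at most Γ / B. The price is the factor B ^ K in `hbound`.
  obtain ⟨F₀, hF₀, hmax⟩ := Finset.exists_max_image 𝓕 (fun G => |γ G| * B ^ G.supp.card) ⟨F, hF⟩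
  set Γ := |γ F₀| with hΓ
  have hbound : ∀ G ∈ 𝓕, |γ G| ≤ Γ * B ^ K := fun G hG' => by
    calc |γ G| ≤ |γ G| * B ^ G.supp.card := le_mul_of_one_le_right (abs_nonneg _) (one_le_pow₀ hB1)
      _ ≤ Γ * B ^ F₀.supp.card := hmax G hG'
      _ ≤ Γ * B ^ K := mul_le_mul_of_nonneg_left (pow_le_pow_right₀ hB1 (hK F₀ hF₀)) (abs_nonneg _)
  have hΓ0 : 0 ≤ Γ := abs_nonneg _
  suffices hmain : κ₀ * Real.exp (-(β * Δ)) * Γ ^ 2 ≤ ‖X * V‖ ^ 2 by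
    refine le_trans ?_ hmain
    have h1 : γ F ^ 2 ≤ (Γ * B ^ K) ^ 2 := by
      rw [← sq_abs]; exact pow_le_pow_left₀ (abs_nonneg _) (hbound F hF) 2
    calc κ₀ / (B ^ K) ^ 2 * Real.exp (-(β * Δ)) * γ F ^ 2
        ≤ κ₀ / (B ^ K) ^ 2 * Real.exp (-(β * Δ)) * (Γ * B ^ K) ^ 2 := by gcongr
      _ = κ₀ * Real.exp (-(β * Δ)) * Γ ^ 2 := by field_simp
  rcases hΓ0.eq_or_lt with h0 | hΓpos
  · rw [← h0]; simp
  by_contra hlt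
  rw [not_le] at hlt
  -- The identity commutes with everything and could not be detected by conjugation.
  have hF₀I : F₀ ≠ fun _ => Pauli.I := fun hFI => by
    rw [hΓ, hI F₀ hF₀ hFI, abs_zero] at hΓpos
    exact lt_irrefl _ hΓpos
  obtain ⟨P, hPR, -, hPagree⟩ := PauliString.exists_sgn_eq_neg_one hF₀I
  set R := F₀.supp with hR
  have hRK : R.card ≤ K := hK F₀ hF₀
  rw [PauliString.mem_supported] at hPR
  have hXs : Xᴴ = X := by
    simp only [hX, conjTranspose_sum, conjTranspose_smul, PauliString.conjTranspose_op,
      RCLike.star_def, Complex.conj_ofReal]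
  set t := Γ / 8 with ht
  have ht0 : 0 < t := by positivity
  obtain ⟨N, hN, hN2, hXN, hNX⟩ := exists_spectral_projection hXs ht0.le
  -- Markov's inequality: were the second moment small, spectral values of X above Γ / 8 would be
  -- rare in the Gibbs state.
  have hNV : ‖N * V‖ ^ 2 ≤ 64 * (κ₀ * Real.exp (-(β * Δ))) := by
    have h1 := pow_le_pow_left₀ (by positivity) (hNX V) 2
    rw [mul_pow, ht] at h1
    have h2 : Γ ^ 2 * (‖N * V‖ ^ 2 / 64) ≤ Γ ^ 2 * (κ₀ * Real.exp (-(β * Δ))) := by linarith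
    have := le_of_mul_le_mul_left h2 (by positivity)
    linarith
  have hleak : ∀ Q : PauliString n, Q.supp ⊆ R → ‖N * (Q.op * V)‖ ≤ α := by
    intro Q hQ
    have h1 := hG.norm_sq_proj_mul_le hβ hN hN2 Q.op_isometry Q.op_coisometry
      (hcomm Q ((Finset.card_le_card hQ).trans hRK)) hs0 hΔ0
    have h2 : h ^ 2 / Δ ^ 2 ≤ α ^ 2 / 3 := by
      rw [hΔ, div_pow, div_div_eq_mul_div, div_le_div_iff₀ (by positivity) (by positivity)]
      nlinarith [mul_nonneg (sq_nonneg α) hh, sq_nonneg α, mul_nonneg (sq_nonneg α) (sq_nonneg h)]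
    have h3 : (1 + 1 / s) * Real.exp (β * Δ) * ‖N * V‖ ^ 2 ≤ α ^ 2 / 3 := by
      calc (1 + 1 / s) * Real.exp (β * Δ) * ‖N * V‖ ^ 2
          ≤ (1 + 1 / s) * Real.exp (β * Δ) * (64 * (κ₀ * Real.exp (-(β * Δ)))) := by gcongr
        _ = (64 * (1 + 1 / s)) * κ₀ * (Real.exp (β * Δ) * Real.exp (-(β * Δ))) := by ring
        _ = α ^ 2 / 3 := by
          rw [← Real.exp_add, add_neg_cancel, Real.exp_zero, mul_one, hκ₀]
          field_simp
    refine abs_le_of_sq_le_sq' ?_ hα0.le |>.2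
    linarith
  set b := 2 * N₁ * B ^ K * Γ with hb
  have hbα : b * α = Γ / 4 := by rw [hb, hα]; field_simp; ring
  -- X itself has no bound independent of the system size. In Z only strings anticommuting with P
  -- survive; they meet R, so at most N₁ remain.
  set Z : Op n := X - P.op * X * P.op with hZ
  have hZe : Z = ∑ G ∈ 𝓕, ((γ G * (1 - P.sgn G) : ℝ) : ℂ) • G.op := by
    rw [hZ, hX, Finset.mul_sum, Finset.sum_mul, ← Finset.sum_sub_distrib]
    refine Finset.sum_congr rfl fun G _ => ?_
    rw [mul_smul_comm, smul_mul_assoc, PauliString.conj_op, smul_smul, ← sub_smul]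
    push_cast
    ring_nf
  have hZb : ∀ M, ‖Z * M‖ ≤ b * ‖M‖ := by
    intro M
    rw [hZe]
    refine (norm_sum_smul_op_mul_le _ _ _).trans
      (mul_le_mul_of_nonneg_right ?_ (norm_nonneg _))
    rw [← Finset.sum_filter_of_ne (p := fun G => ¬ Disjoint R G.supp)]
    · calc ∑ G ∈ 𝓕.filter (fun G => ¬ Disjoint R G.supp), |γ G * (1 - P.sgn G)|
          ≤ ∑ G ∈ 𝓕.filter (fun G => ¬ Disjoint R G.supp), 2 * (Γ * B ^ K) := by
            refine Finset.sum_le_sum fun G hG' => ?_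
            have h1 := hbound G (Finset.mem_filter.1 hG').1
            have h2 : |1 - P.sgn G| ≤ 2 := by
              rcases P.sgn_eq_or G with h | h <;> rw [h] <;> norm_num
            rw [abs_mul, mul_comm]
            exact mul_le_mul h2 h1 (abs_nonneg _) (by norm_num)
        _ ≤ N₁ * (2 * (Γ * B ^ K)) := by
            rw [Finset.sum_const, nsmul_eq_mul]
            refine mul_le_mul_of_nonneg_right ?_ (by positivity)
            exact_mod_cast hcount R hRK
        _ = b := by rw [hb]; ring
    · intro G _ hne hdis
      apply hne
      rw [PauliString.sgn_eq_one_of_disjoint (Finset.disjoint_of_subset_left hPR hdis)]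
      simp
  have upper : ∀ Q ∈ PauliString.supported R,
      ‖((F₀.op * V)ᴴ * (Q.op * Z * Q.op * V)).trace‖ ≤ 3 / 4 * Γ := by
    intro Q hQ
    rw [PauliString.mem_supported] at hQ
    have h1 : (F₀.op * V)ᴴ * (Q.op * Z * Q.op * V) =
        (Q.op * (F₀.op * V))ᴴ * (Z * (Q.op * V)) := by
      rw [conjTranspose_mul Q.op, Q.conjTranspose_op]
      simp only [mul_assoc]
    rw [h1]
    have hVn : ‖V‖ = 1 := hG.norm_root
    refine (norm_trace_sub_conj_le (α := α) (t := t) (b := b) hXs P.conjTranspose_op P.op_mul_self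
      hN hN2 hZ ht0.le hXN (by positivity) hZb ?_ ?_ (hleak Q hQ) ?_).trans ?_
    · rw [Q.norm_op_mul, hVn]
    · rw [Q.norm_op_mul, F₀.norm_op_mul, hVn]
    -- Up to a phase, P Q F₀ is again a Pauli string on R, so the leakage bound applies to it too.
    · obtain ⟨J, z, hz, hJ, hJe⟩ := PauliString.exists_op_mul Q F₀
      obtain ⟨J', z', hz', hJ', hJe'⟩ := PauliString.exists_op_mul P J
      have : P.op * (Q.op * (F₀.op * V)) = (z * z') • (J'.op * V) := by
        rw [← mul_assoc Q.op, hJe, smul_mul_assoc, mul_smul_comm, ← mul_assoc, hJe',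
          smul_mul_assoc, smul_smul]
      rw [this, mul_smul_comm, norm_smul, norm_mul, hz, hz', one_mul, one_mul]
      exact hleak J' (hJ'.trans (Finset.union_subset hPR (hJ.trans
        (Finset.union_subset hQ subset_rfl))))
    · rw [mul_assoc, hbα, ht]; linarith
  have hsum : ∑ Q ∈ PauliString.supported R, (Q.sgn F₀ : ℂ) • (Q.op * Z * Q.op) =
      (4 : ℂ) ^ R.card • (2 : ℂ) • ∑ G ∈ 𝓕 with ∀ i ∈ R, F₀ i = G i, (γ G : ℂ) • G.op := by
    rw [hZe, sum_sgn_smul_conj]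
    congr 1
    rw [Finset.smul_sum]
    refine Finset.sum_congr rfl fun G hG' => ?_
    rw [hPagree G (Finset.mem_filter.1 hG').2, smul_smul]
    push_cast
    ring_nf
  set S := 𝓕.filter fun G => ∀ i ∈ R, F₀ i = G i with hS
  have hF₀S : F₀ ∈ S := Finset.mem_filter.2 ⟨hF₀, fun _ _ => rfl⟩
  have hVn : ‖V‖ = 1 := hG.norm_root
  have hrest : ∑ G ∈ S.erase F₀, |γ G| ≤ Γ / 2 := by
    have h1 : ∀ G ∈ S.erase F₀, |γ G| ≤ Γ / B := by
      intro G hG'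
      obtain ⟨hne, hGS⟩ := Finset.mem_erase.1 hG'
      obtain ⟨hGF, hag⟩ := Finset.mem_filter.1 hGS
      have hlt := Finset.card_lt_card (PauliString.supp_ssubset_of_agree hag hne)
      have h2 : |γ G| * B * B ^ R.card ≤ Γ * B ^ R.card := by
        refine le_trans ?_ (hmax G hGF)
        rw [mul_assoc, ← pow_succ']
        exact mul_le_mul_of_nonneg_left (pow_le_pow_right₀ hB1 hlt) (abs_nonneg _)
      rw [le_div_iff₀ hB0]
      exact le_of_mul_le_mul_right h2 (by positivity)
    -- These strings contain the nonempty set R in their support, so they are among those counted by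
    -- `hcount`.
    have h2 : (S.erase F₀).card ≤ N₁ := by
      refine le_trans (Finset.card_le_card fun G hG' => ?_) (hcount R hRK)
      obtain ⟨hne, hGS⟩ := Finset.mem_erase.1 hG'
      obtain ⟨hGF, hag⟩ := Finset.mem_filter.1 hGS
      refine Finset.mem_filter.2 ⟨hGF, fun hd => ?_⟩
      have hsub := (PauliString.supp_ssubset_of_agree hag hne).subset
      have hRe : R = ∅ := by
        rw [← Finset.disjoint_self_iff_empty]
        exact Finset.disjoint_of_subset_right hsub hd
      apply hF₀I
      funext i
      by_contra hi
      have : i ∈ R := by simpa [hR, PauliString.supp] using hi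
      rw [hRe] at this
      exact Finset.notMem_empty _ this
    calc ∑ G ∈ S.erase F₀, |γ G| ≤ (S.erase F₀).card * (Γ / B) := by
          rw [← nsmul_eq_mul]; exact Finset.sum_le_card_nsmul _ _ _ h1
      _ ≤ N₁ * (Γ / B) := by
          refine mul_le_mul_of_nonneg_right ?_ (by positivity)
          exact_mod_cast h2
      _ = Γ / 2 := by rw [hB]; field_simp
  have lower : Γ / 2 ≤ ‖((F₀.op * V)ᴴ * ((∑ G ∈ S, (γ G : ℂ) • G.op) * V)).trace‖ := by
    rw [← Finset.add_sum_erase _ _ hF₀S, add_mul, mul_add, trace_add]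
    have h1 : ((F₀.op * V)ᴴ * ((γ F₀ : ℂ) • F₀.op * V)).trace = (γ F₀ : ℂ) := by
      rw [smul_mul_assoc, mul_smul_comm, trace_smul, ← frobenius_norm_sq_eq_trace, F₀.norm_op_mul,
        hVn]
      simp
    have h2 : ‖((F₀.op * V)ᴴ * ((∑ G ∈ S.erase F₀, (γ G : ℂ) • G.op) * V)).trace‖ ≤ Γ / 2 := by
      refine (norm_trace_conjTranspose_mul_le _ _).trans ?_
      rw [F₀.norm_op_mul, hVn, one_mul]
      refine (norm_sum_smul_op_mul_le _ _ _).trans ?_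
      rwa [hVn, mul_one]
    have h3 : ‖(γ F₀ : ℂ)‖ = Γ := by rw [Complex.norm_real, Real.norm_eq_abs]
    rw [h1]
    have := norm_sub_le_norm_add (γ F₀ : ℂ)
      ((F₀.op * V)ᴴ * ((∑ G ∈ S.erase F₀, (γ G : ℂ) • G.op) * V)).trace
    linarith
  -- The factor 2 from P anticommuting with every survivor compensates the loss of Γ / 2 in `lower`,
  -- while each of the 4 ^ |R| averaged terms is at most 3Γ / 4.
  have tot : (4 : ℝ) ^ R.card * Γ ≤ 4 ^ R.card * (3 / 4 * Γ) := by
    calc (4 : ℝ) ^ R.card * Γ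
        ≤ ‖((4 : ℂ) ^ R.card * 2) * ((F₀.op * V)ᴴ *
            ((∑ G ∈ S, (γ G : ℂ) • G.op) * V)).trace‖ := by
          rw [norm_mul]
          have : ‖(4 : ℂ) ^ R.card * 2‖ = 4 ^ R.card * 2 := by simp
          rw [this, mul_assoc]
          refine mul_le_mul_of_nonneg_left ?_ (by positivity)
          linarith
      _ = ‖∑ Q ∈ PauliString.supported R,
            (Q.sgn F₀ : ℂ) * ((F₀.op * V)ᴴ * (Q.op * Z * Q.op * V)).trace‖ := by
          congr 1
          rw [← smul_eq_mul, ← trace_smul, ← mul_smul_comm, ← smul_mul_assoc, mul_smul, ← hsum,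
            Finset.sum_mul, Finset.mul_sum, trace_sum]
          refine Finset.sum_congr rfl fun Q _ => ?_
          rw [smul_mul_assoc, mul_smul_comm, trace_smul, smul_eq_mul]
      _ ≤ ∑ Q ∈ PauliString.supported R, 3 / 4 * Γ := by
          refine (norm_sum_le _ _).trans (Finset.sum_le_sum fun Q hQ => ?_)
          have : ‖(Q.sgn F₀ : ℂ)‖ = 1 := by
            rcases Q.sgn_eq_or F₀ with h | h <;> rw [h] <;> simp
          rw [norm_mul, this, one_mul]
          exact upper Q hQ
      _ = 4 ^ R.card * (3 / 4 * Γ) := by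
          rw [Finset.sum_const, PauliString.card_supported, nsmul_eq_mul]
          push_cast
          ring
  have := le_of_mul_le_mul_left tot (by positivity)
  linarith

end Variance

/-! ### Locality of the Hamiltonian -/

section Locality

open scoped Matrix.Norms.Frobenius

variable {n m k d : ℕ} {E : Fin m → PauliString n}

open Classical in
/-- The closed neighbourhood of a term in the dual interaction graph. -/
def closedNbr (E : Fin m → PauliString n) (a : Fin m) : Finset (Fin m) :=
  Finset.univ.filter fun b => b = a ∨ (dualGraph E).Adj a b

theorem mem_closedNbr {a b : Fin m} : b ∈ closedNbr E a ↔ b = a ∨ (dualGraph E).Adj a b := by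
  simp [closedNbr]

theorem mem_closedNbr_of_not_disjoint {a b : Fin m} (h : ¬ Disjoint (E a).supp (E b).supp) :
    b ∈ closedNbr E a := by
  rw [mem_closedNbr]
  by_cases hab : b = a
  · exact Or.inl hab
  · exact Or.inr ⟨Ne.symm hab, Finset.not_disjoint_iff_nonempty_inter.1 h⟩

theorem IsLowIntersection.card_closedNbr_le (hE : IsLowIntersection k d E) (a : Fin m) :
    (closedNbr E a).card ≤ d + 1 := by
  classical
  have h1 : closedNbr E a = insert a ((dualGraph E).neighborSet a).toFinset := by
    ext b; simp [mem_closedNbr]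
  rw [h1]
  refine (Finset.card_insert_le _ _).trans (Nat.succ_le_succ ?_)
  rw [← Set.ncard_eq_toFinset_card']
  exact hE.degree_le a

/-- A connected set of at most two vertices is a vertex or an edge; the closed neighbourhood covers
both cases. -/
theorem mem_localPaulis_two {F : PauliString n} : F ∈ localPaulis E 2 ↔
    ∃ a, ∃ b ∈ closedNbr E a, F.supp ⊆ (E a).supp ∪ (E b).supp := by
  classical
  simp only [localPaulis, Finset.mem_filter, Finset.mem_univ, true_and]
  constructor
  · rintro ⟨S, hS, hconn, hF⟩
    obtain ⟨⟨a, ha⟩⟩ := hconn.nonempty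
    have ha' : a ∈ S := ha
    by_cases h1 : S = {a}
    · exact ⟨a, a, mem_closedNbr.2 (Or.inl rfl), by simpa [h1] using hF⟩
    · obtain ⟨b, hb, hba⟩ : ∃ b ∈ S, b ≠ a := by
        by_contra! h
        exact h1 (Finset.eq_singleton_iff_unique_mem.2 ⟨ha', h⟩)
      have hSe : S = {a, b} := by
        refine (Finset.eq_of_subset_of_card_le ?_ ?_).symm
        · simp [Finset.insert_subset_iff, ha', hb]
        · rwa [Finset.card_pair hba.symm]
      have : Nontrivial (S : Set (Fin m)) := ⟨⟨⟨a, ha⟩, ⟨b, hb⟩, fun h => hba (congrArg Subtype.val h).symm⟩⟩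
      obtain ⟨⟨c, hc⟩, hadj⟩ := hconn.preconnected.exists_adj_of_nontrivial ⟨a, ha⟩
      have hadj' : (dualGraph E).Adj a c := hadj
      have hcS : c ∈ S := hc
      rw [hSe] at hcS
      simp only [Finset.mem_insert, Finset.mem_singleton] at hcS
      rcases hcS with rfl | rfl
      · exact absurd hadj' ((dualGraph E).irrefl)
      · exact ⟨a, c, mem_closedNbr.2 (Or.inr hadj'), by simpa [hSe] using hF⟩
  · rintro ⟨a, b, hb, hF⟩
    refine ⟨{a, b}, Finset.card_le_two, ?_, by simpa using hF⟩
    rcases mem_closedNbr.1 hb with rfl | hadj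
    · rw [Finset.pair_eq_singleton, Finset.coe_singleton]
      exact SimpleGraph.Connected.of_subsingleton
    · rw [Finset.coe_pair]
      exact SimpleGraph.induce_pair_connected_of_adj hadj

theorem mem_localPaulis_self {ℓ : ℕ} (hℓ : 1 ≤ ℓ) (a : Fin m) : E a ∈ localPaulis E ℓ := by
  classical
  simp only [localPaulis, Finset.mem_filter, Finset.mem_univ, true_and]
  refine ⟨{a}, by simpa using hℓ, ?_, by simp⟩
  rw [Finset.coe_singleton]
  exact SimpleGraph.Connected.of_subsingleton

theorem IsLowIntersection.card_supp_le_of_mem (hE : IsLowIntersection k d E) {F : PauliString n}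
    (hF : F ∈ localPaulis E 2) : F.supp.card ≤ 2 * k := by
  obtain ⟨a, b, -, hF⟩ := mem_localPaulis_two.1 hF
  refine (Finset.card_le_card hF).trans ((Finset.card_union_le _ _).trans ?_)
  have := hE.card_supp a
  have := hE.card_supp b
  omega

open Classical in
-- Terms sharing a qubit are pairwise equal or adjacent, so they lie in the closed neighbourhood of
-- any one of them.
theorem IsLowIntersection.card_filter_mem_le (hE : IsLowIntersection k d E) (i : Fin n) :
    (Finset.univ.filter fun a => i ∈ (E a).supp).card ≤ d + 1 := by
  by_cases h : ∃ a, i ∈ (E a).supp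
  · obtain ⟨a, ha⟩ := h
    refine (Finset.card_le_card fun b hb => ?_).trans (hE.card_closedNbr_le a)
    exact mem_closedNbr_of_not_disjoint (Finset.not_disjoint_iff.2 ⟨i, ha, by simpa using hb⟩)
  · push Not at h
    simp [h]

open Classical in
theorem IsLowIntersection.card_filter_not_disjoint_le (hE : IsLowIntersection k d E)
    {R : Finset (Fin n)} (hR : R.card ≤ 2 * k) :
    (Finset.univ.filter fun a => ¬ Disjoint R (E a).supp).card ≤ 2 * k * (d + 1) := by
  calc _ ≤ (R.biUnion fun i => Finset.univ.filter fun a => i ∈ (E a).supp).card := by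
        refine Finset.card_le_card fun a ha => ?_
        obtain ⟨i, hi, hia⟩ := Finset.not_disjoint_iff.1 (Finset.mem_filter.1 ha).2
        exact Finset.mem_biUnion.2 ⟨i, hi, by simpa using hia⟩
    _ ≤ R.card * (d + 1) := Finset.card_biUnion_le_card_mul _ _ _ fun i _ => hE.card_filter_mem_le i
    _ ≤ 2 * k * (d + 1) := Nat.mul_le_mul_right _ hR

theorem IsLowIntersection.card_localPaulis_filter_le (hE : IsLowIntersection k d E)
    {R : Finset (Fin n)} (hR : R.card ≤ 2 * k) :
    ((localPaulis E 2).filter fun G => ¬ Disjoint R G.supp).card ≤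
      2 * k * (d + 1) * ((d + 1) * 4 ^ (2 * k)) := by
  classical
  calc _ ≤ ((Finset.univ.filter fun a => ¬ Disjoint R (E a).supp).biUnion fun a =>
        (closedNbr E a).biUnion fun b =>
          PauliString.supported ((E a).supp ∪ (E b).supp)).card := by
        refine Finset.card_le_card fun G hG => ?_
        obtain ⟨hG, hd⟩ := Finset.mem_filter.1 hG
        obtain ⟨a, b, hb, hGs⟩ := mem_localPaulis_two.1 hG
        simp only [Finset.mem_biUnion, Finset.mem_filter, Finset.mem_univ, true_and,
          PauliString.mem_supported]
        -- If the first term misses R then the second one meets it, and the symmetry of adjacency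
        -- exchanges their roles.
        by_cases hda : Disjoint R (E a).supp
        · refine ⟨b, fun hdb => hd ?_, a, ?_, by rwa [Finset.union_comm]⟩
          · exact Finset.disjoint_of_subset_right hGs (Finset.disjoint_union_right.2 ⟨hda, hdb⟩)
          · rw [mem_closedNbr] at hb ⊢
            exact hb.imp Eq.symm fun h => h.symm
        · exact ⟨a, hda, b, hb, hGs⟩
    _ ≤ _ := by
        refine (Finset.card_biUnion_le_card_mul _ _ ((d + 1) * 4 ^ (2 * k)) fun a _ => ?_).trans
          (Nat.mul_le_mul_right _ (hE.card_filter_not_disjoint_le hR))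
        refine (Finset.card_biUnion_le_card_mul _ _ (4 ^ (2 * k)) fun b _ => ?_).trans
          (Nat.mul_le_mul_right _ (hE.card_closedNbr_le a))
        rw [PauliString.card_supported]
        refine Nat.pow_le_pow_right (by norm_num) ((Finset.card_union_le _ _).trans ?_)
        have := hE.card_supp a
        have := hE.card_supp b
        omega

theorem conjTranspose_hamiltonian (E : Fin m → PauliString n) (lam : Fin m → ℝ) :
    (hamiltonian E lam)ᴴ = hamiltonian E lam := by
  simp only [hamiltonian, conjTranspose_sum, conjTranspose_smul, PauliString.conjTranspose_op,
    RCLike.star_def, Complex.conj_ofReal]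

/-- Only terms meeting the support of P contribute, each at most 2. This is the
system-size-independent energy change h in the variance bound. -/
theorem IsLowIntersection.norm_comm_mul_le (hE : IsLowIntersection k d E) {lam : Fin m → ℝ}
    (hlam : ∀ a, |lam a| ≤ 1) {P : PauliString n} (hP : P.supp.card ≤ 2 * k) {V : Op n}
    (hV : ‖V‖ = 1) :
    ‖(hamiltonian E lam * P.op - P.op * hamiltonian E lam) * V‖ ≤ 2 * (2 * k * (d + 1)) := by
  classical
  have h1 : (hamiltonian E lam * P.op - P.op * hamiltonian E lam) * V =
      ∑ a, ((lam a * ((E a).sgn P - 1) : ℝ) : ℂ) • (P.op * ((E a).op * V)) := by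
    rw [hamiltonian, Finset.sum_mul, Finset.mul_sum, ← Finset.sum_sub_distrib, Finset.sum_mul]
    refine Finset.sum_congr rfl fun a _ => ?_
    rw [smul_mul_assoc, mul_smul_comm, PauliString.op_mul_comm, smul_smul, ← sub_smul,
      smul_mul_assoc, mul_assoc]
    push_cast
    ring_nf
  rw [h1, ← Finset.sum_filter_of_ne (p := fun a => ¬ Disjoint P.supp (E a).supp)]
  · refine (norm_sum_le_of_le (n := fun _ => (2 : ℝ)) _ fun a _ => ?_).trans ?_
    · rw [norm_smul, P.norm_op_mul, PauliString.norm_op_mul, hV, mul_one, Complex.norm_real,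
        Real.norm_eq_abs, abs_mul]
      have h2 : |(E a).sgn P - 1| ≤ 2 := by
        rcases (E a).sgn_eq_or P with h | h <;> rw [h] <;> norm_num
      calc _ ≤ 1 * (2 : ℝ) := mul_le_mul (hlam a) h2 (abs_nonneg _) zero_le_one
        _ = 2 := one_mul 2
    · rw [Finset.sum_const, nsmul_eq_mul, mul_comm]
      refine mul_le_mul_of_nonneg_left ?_ (by norm_num)
      exact_mod_cast hE.card_filter_not_disjoint_le hP
  · intro a _ hne hd
    apply hne
    rw [PauliString.sgn_eq_one_of_disjoint hd.symm]
    simp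

/-- H applied to an eigenvector is a sum of m Pauli isometries with coefficients at most 1 in
modulus. -/
theorem GibbsBasis.abs_energy_le {lam : Fin m → ℝ} (hlam : ∀ a, |lam a| ≤ 1) {β : ℝ} {U : Op n}
    {e r : (Fin n → Fin 2) → ℝ} (hG : GibbsBasis β (hamiltonian E lam) U e r)
    (i : Fin n → Fin 2) : |e i| ≤ m := by
  set M : Op n := U * Matrix.single i i 1 with hM
  have hMn : ‖M‖ = 1 := by
    rw [hM, norm_mul_of_isometry hG.left]
    have : ‖(Matrix.single i i 1 : Op n)‖ ^ 2 = 1 := by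
      rw [frobenius_norm_sq, Finset.sum_eq_single i, Finset.sum_eq_single i]
      · simp
      · intro j _ hj; simp [hj.symm]
      · simp
      · intro j _ hj; simp [hj.symm]
      · simp
    exact (pow_eq_one_iff_of_nonneg (norm_nonneg _) two_ne_zero).1 this
  have h1 : hamiltonian E lam * M = (e i : ℂ) • M := by
    rw [hG.diag, hM, mul_assoc, ← mul_assoc Uᴴ, hG.left, one_mul, mul_assoc, ← mul_smul_comm]
    congr 1
    ext x y
    rw [diagonal_mul, Matrix.smul_apply, smul_eq_mul]
    by_cases hx : i = x
    · rw [hx]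
    · simp [hx]
  have h2 : ‖hamiltonian E lam * M‖ ≤ ∑ _a : Fin m, (1 : ℝ) := by
    rw [hamiltonian, Finset.sum_mul]
    refine norm_sum_le_of_le _ fun a _ => ?_
    rw [smul_mul_assoc, norm_smul, PauliString.norm_op_mul, hMn, mul_one, Complex.norm_real]
    exact hlam a
  rw [h1, norm_smul, hMn, mul_one, Complex.norm_real] at h2
  simpa using h2

theorem comm_eq_sum (lam lam' : Fin m → ℝ) :
    hamiltonian E lam * hamiltonian E lam' - hamiltonian E lam' * hamiltonian E lam =
      ∑ a, ∑ b, ((lam a * lam' b : ℝ) : ℂ) •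
        ((E a).op * (E b).op - (E b).op * (E a).op) := by
  simp only [hamiltonian, Finset.sum_mul, Finset.mul_sum, smul_sub, Finset.sum_sub_distrib,
    smul_mul_assoc, mul_smul_comm, Finset.smul_sum, smul_smul]
  congr 1
  · rw [Finset.sum_comm]
    refine Finset.sum_congr rfl fun a _ => Finset.sum_congr rfl fun b _ => ?_
    push_cast; rw [mul_comm]
  · refine Finset.sum_congr rfl fun a _ => Finset.sum_congr rfl fun b _ => ?_
    push_cast; rfl

theorem op_mul_comm_of_notMem_closedNbr {a b : Fin m} (h : b ∉ closedNbr E a) :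
    (E a).op * (E b).op = (E b).op * (E a).op := by
  have : Disjoint (E a).supp (E b).supp := by
    by_contra hd
    exact h (mem_closedNbr_of_not_disjoint hd)
  rw [PauliString.op_mul_comm, PauliString.sgn_eq_one_of_disjoint this]
  simp

theorem exists_comm_term (E : Fin m → PauliString n) (a b : Fin m) :
    ∃ R ∈ localPaulis E 2, ∃ c : ℝ,
      Complex.I • ((E a).op * (E b).op - (E b).op * (E a).op) = (c : ℂ) • R.op := by
  by_cases hb : b ∈ closedNbr E a
  · rcases (E a).sgn_eq_or (E b) with hs | hs
    · refine ⟨E a, mem_localPaulis_self (by norm_num) a, 0, ?_⟩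
      rw [PauliString.op_mul_comm, hs]
      simp
    · obtain ⟨R, z, -, hR, hRe⟩ := PauliString.exists_op_mul (E a) (E b)
      have hR2 : R ∈ localPaulis E 2 := mem_localPaulis_two.2 ⟨a, b, hb, hR⟩
      set w : ℂ := Complex.I * (2 * z) with hw
      have h1 : Complex.I • ((E a).op * (E b).op - (E b).op * (E a).op) = w • R.op := by
        have : (E b).op * (E a).op = -((E a).op * (E b).op) := by
          rw [PauliString.op_mul_comm (E a), hs]; simp
        rw [this, sub_neg_eq_add, ← two_smul ℂ, hRe, smul_smul, smul_smul, mul_assoc]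
      -- i times a commutator of Hermitian matrices is Hermitian, which forces the coefficient to be
      -- real.
      have h2 : star w • R.op = w • R.op := by
        have := congrArg conjTranspose h1
        rw [conjTranspose_smul, conjTranspose_smul, conjTranspose_sub, conjTranspose_mul,
          conjTranspose_mul] at this
        simp only [PauliString.conjTranspose_op] at this
        rw [← this, ← h1, RCLike.star_def, Complex.conj_I, neg_smul, ← smul_neg, neg_sub]
      have h3 : star w = w := smul_left_injective ℂ R.op_ne_zero h2
      exact ⟨R, hR2, w.re, by rw [h1, Complex.conj_eq_iff_re.1 h3]⟩
  · refine ⟨E a, mem_localPaulis_self (by norm_num) a, 0, ?_⟩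
    rw [op_mul_comm_of_notMem_closedNbr hb]
    simp

theorem exists_isCommutatorExpansion (E : Fin m → PauliString n) (lam : Fin m → ℝ) :
    ∃ γ, IsCommutatorExpansion E lam γ := by
  choose R hR c hc using exists_comm_term E
  refine ⟨fun F => ∑ a, ∑ b, if R a b = F then
    MvPolynomial.C (lam a * c a b) * MvPolynomial.X b else 0, ?_, ?_⟩
  · intro F _
    refine MvPolynomial.IsHomogeneous.sum _ _ _ fun a _ =>
      MvPolynomial.IsHomogeneous.sum _ _ _ fun b _ => ?_
    split_ifs
    · exact MvPolynomial.isHomogeneous_C_mul_X _ _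
    · exact MvPolynomial.isHomogeneous_zero _ _ _
  · intro lam'
    rw [comm_eq_sum, Finset.smul_sum]
    simp only [map_sum, Complex.ofReal_sum, Finset.sum_smul, Finset.smul_sum]
    rw [Finset.sum_comm]
    conv_rhs => rw [Finset.sum_comm]; enter [2, a]; rw [Finset.sum_comm]
    rw [Finset.sum_comm]
    refine Finset.sum_congr rfl fun a _ => Finset.sum_congr rfl fun b _ => ?_
    rw [Finset.sum_eq_single (R a b)]
    · rw [smul_comm, hc, if_pos rfl, smul_smul]
      simp only [map_mul, MvPolynomial.eval_C, MvPolynomial.eval_X]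
      push_cast
      ring_nf
    · intro F _ hF
      rw [if_neg hF.symm]; simp
    · exact fun h => absurd (hR a b) h

/-- A commutator has trace zero, and the identity is the only Pauli string with nonzero trace. -/
theorem IsCommutatorExpansion.coeff_I_eq_zero {lam : Fin m → ℝ}
    {γ : PauliString n → MvPolynomial (Fin m) ℝ} (hγ : IsCommutatorExpansion E lam γ)
    (lam' : Fin m → ℝ) {F : PauliString n} (hF : F ∈ localPaulis E 2)
    (hFI : F = fun _ => Pauli.I) : MvPolynomial.eval lam' (γ F) = 0 := by
  have h := congrArg Matrix.trace (hγ.2 lam')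
  rw [trace_smul, trace_sub, trace_mul_comm, sub_self, smul_zero, trace_sum,
    Finset.sum_eq_single F] at h
  · rw [trace_smul, PauliString.trace_op, if_pos hFI] at h
    simpa using h
  · intro G _ hG
    rw [trace_smul, PauliString.trace_op, if_neg (hFI ▸ hG), smul_zero]
  · exact fun h => absurd hF h

end Locality

/-! ### Sum-of-squares proofs of degree two -/

section SoS

open MvPolynomial

variable {σ : Type*} {𝒞 : Set (MvPolynomial σ ℝ)} {ℓ : ℕ}

theorem SoSProves.add {g g' : MvPolynomial σ ℝ} (h : SoSProves 𝒞 ℓ g) (h' : SoSProves 𝒞 ℓ g') :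
    SoSProves 𝒞 ℓ (g + g') := by
  obtain ⟨N, p, S, hS, hd, rfl⟩ := h
  obtain ⟨N', p', S', hS', hd', rfl⟩ := h'
  refine ⟨N + N', Fin.append p p', Fin.append S S', fun j => ?_, fun j => ?_, ?_⟩
  · refine Fin.addCases (fun i => ?_) (fun i => ?_) j
    · simpa using hS i
    · simpa using hS' i
  · refine Fin.addCases (fun i => ?_) (fun i => ?_) j
    · simpa using hd i
    · simpa using hd' i
  · simp [Fin.sum_univ_add]

theorem SoSProves.zero : SoSProves 𝒞 ℓ 0 :=
  ⟨0, Fin.elim0, Fin.elim0, fun j => j.elim0, fun j => j.elim0, by simp⟩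

theorem SoSProves.sum {α : Type*} {s : Finset α} {g : α → MvPolynomial σ ℝ}
    (h : ∀ a ∈ s, SoSProves 𝒞 ℓ (g a)) : SoSProves 𝒞 ℓ (∑ a ∈ s, g a) := by
  classical
  induction s using Finset.induction_on with
  | empty => simpa using SoSProves.zero
  | insert a s ha ih =>
    rw [Finset.sum_insert ha]
    exact (h a (Finset.mem_insert_self a s)).add
      (ih fun b hb => h b (Finset.mem_insert_of_mem hb))

theorem SoSProves.const_mul {g : MvPolynomial σ ℝ} (h : SoSProves 𝒞 ℓ g) {c : ℝ} (hc : 0 ≤ c) :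
    SoSProves 𝒞 ℓ (C c * g) := by
  obtain ⟨N, p, S, hS, hd, rfl⟩ := h
  have h1 : ∀ j, (C √c * p j) ^ 2 * ∏ f ∈ S j, f = C c * (p j ^ 2 * ∏ f ∈ S j, f) := fun j => by
    rw [mul_pow, ← C_pow, Real.sq_sqrt hc, mul_assoc]
  refine ⟨N, fun j => C √c * p j, S, hS, fun j => ?_, ?_⟩
  · rw [h1, C_mul']
    exact (totalDegree_smul_le _ _).trans (hd j)
  · rw [Finset.mul_sum]
    exact Finset.sum_congr rfl fun j _ => (h1 j).symm

theorem SoSProves.sq {p : MvPolynomial σ ℝ} (hp : p.totalDegree ≤ 1) :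
    SoSProves 𝒞 2 (p ^ 2) := by
  refine ⟨1, fun _ => p, fun _ => ∅, by simp, fun _ => ?_, by simp⟩
  rw [Finset.prod_empty, mul_one]
  exact (totalDegree_pow _ _).trans (Nat.mul_le_mul_left 2 hp)

theorem SoSProves.const {c : ℝ} (hc : 0 ≤ c) : SoSProves 𝒞 2 (C c : MvPolynomial σ ℝ) := by
  have h := (SoSProves.sq (𝒞 := 𝒞) (p := (1 : MvPolynomial σ ℝ)) (by simp)).const_mul hc
  simpa using h

theorem SoSProves.of_mem {g : MvPolynomial σ ℝ} (hg : g ∈ 𝒞) (hd : g.totalDegree ≤ ℓ) :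
    SoSProves 𝒞 ℓ g :=
  ⟨1, fun _ => 1, fun _ => {g}, by simpa using hg, by simpa using hd, by simp⟩

theorem SoSProves.mul_of_mem {g g' : MvPolynomial σ ℝ} (hg : g ∈ 𝒞) (hg' : g' ∈ 𝒞) (hne : g ≠ g')
    (hd : (g * g').totalDegree ≤ ℓ) : SoSProves 𝒞 ℓ (g * g') := by
  classical
  refine ⟨1, fun _ => 1, fun _ => {g, g'}, fun _ => ?_, fun _ => ?_, ?_⟩
  · rw [Finset.coe_pair]
    exact Set.insert_subset hg (by simpa using hg')
  · rwa [Finset.prod_pair hne, one_pow, one_mul]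
  · simp [Finset.prod_pair hne]

/-- `g² ≤ K / q` yields `|g| ≤ M` when `K ≤ q M²`. -/
theorem SoSProves.bound_of_sq_le {g W : MvPolynomial σ ℝ} {K q M : ℝ} (hK : SoSProves 𝒞 2 (C K - W))
    (hW : SoSProves 𝒞 2 (W - C q * g ^ 2)) (hq : 0 < q) (hM : 0 < M) (hKM : K ≤ q * M ^ 2)
    (hg : g.totalDegree ≤ 1) : SoSProves 𝒞 2 (C M - g) ∧ SoSProves 𝒞 2 (g + C M) := by
  have hsq : SoSProves 𝒞 2 (C (M ^ 2) - g ^ 2) := by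
    have h1 := ((hK.add hW).const_mul (c := 1 / q) (by positivity)).add
      (SoSProves.const (𝒞 := 𝒞) (c := M ^ 2 - K / q)
        (by rw [sub_nonneg, div_le_iff₀ hq]; linarith))
    convert h1 using 1
    have e1 : (C (1 / q) * C q : MvPolynomial σ ℝ) = 1 := by
      rw [← C_mul, one_div_mul_cancel hq.ne', C_1]
    have e2 : (C (K / q) : MvPolynomial σ ℝ) = C (1 / q) * C K := by
      rw [← C_mul]; congr 1; ring
    rw [C_sub, e2]
    linear_combination g ^ 2 * e1
  -- M + p = ((M + p)² + (M² - p²)) / (2M), applied to p = ± g.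
  have key : ∀ p : MvPolynomial σ ℝ, p.totalDegree ≤ 1 → p ^ 2 = g ^ 2 →
      SoSProves 𝒞 2 (C M + p) := by
    intro p hp hpg
    have h1 := ((SoSProves.sq (𝒞 := 𝒞) (p := C M + p)
      ((totalDegree_add _ _).trans (by simpa using hp))).add hsq).const_mul
        (c := 1 / (2 * M)) (by positivity)
    convert h1 using 1
    have e1 : (C (1 / (2 * M)) * (2 * C M) : MvPolynomial σ ℝ) = 1 := by
      rw [← C_1, show (2 : MvPolynomial σ ℝ) = C 2 from (map_ofNat C 2).symm, ← C_mul, ← C_mul,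
        one_div_mul_cancel (by positivity)]
    rw [C_pow, ← hpg]
    linear_combination -(C M + p) * e1
  constructor
  · rw [sub_eq_add_neg]
    exact key _ (by rwa [totalDegree_neg]) (by ring)
  · rw [add_comm]
    exact key _ hg rfl

variable {m : ℕ}

/-- The linear form with coefficients `c`. -/
def linForm (c : Fin m → ℝ) : MvPolynomial (Fin m) ℝ := ∑ a, C (c a) * X a

theorem totalDegree_C_mul_X_le (c : ℝ) (a : Fin m) :
    (C c * X a : MvPolynomial (Fin m) ℝ).totalDegree ≤ 1 := by
  rw [C_mul']
  exact (totalDegree_smul_le _ _).trans (totalDegree_X a).le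

theorem totalDegree_linForm_le (c : Fin m → ℝ) : (linForm c).totalDegree ≤ 1 :=
  totalDegree_finsetSum_le fun a _ => totalDegree_C_mul_X_le (c a) a

theorem eval_linForm (c x : Fin m → ℝ) : eval x (linForm c) = ∑ a, c a * x a := by
  simp [linForm]

theorem exists_eq_linForm {p : MvPolynomial (Fin m) ℝ} (hp : p.IsHomogeneous 1) :
    ∃ c, p = linForm c := by
  have h1 : p ∈ homogeneousSubmodule (Fin m) ℝ 1 := hp
  rw [homogeneousSubmodule_one_eq_span_X, Submodule.mem_span_range_iff_exists_fun] at h1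
  obtain ⟨c, hc⟩ := h1
  exact ⟨c, by simp [← hc, linForm, C_mul']⟩

/-- A positive semidefinite quadratic form is a sum of squares of linear forms. -/
theorem SoSProves.quadForm {𝒞 : Set (MvPolynomial (Fin m) ℝ)} {w : Fin m → Fin m → ℝ}
    (hw : ∀ x : Fin m → ℝ, 0 ≤ ∑ b, ∑ c, w b c * (x b * x c)) :
    SoSProves 𝒞 2 (∑ b, ∑ c, C (w b c) * (X b * X c)) := by
  set M : Matrix (Fin m) (Fin m) ℝ := Matrix.of fun b c => (w b c + w c b) / 2 with hM
  have hsymm : ∀ x : Fin m → ℝ, ∑ b, ∑ c, M b c * (x b * x c) = ∑ b, ∑ c, w b c * (x b * x c) := by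
    intro x
    have h1 : ∑ b, ∑ c, w c b * (x b * x c) = ∑ b, ∑ c, w b c * (x b * x c) := by
      rw [Finset.sum_comm]
      refine Finset.sum_congr rfl fun b _ => Finset.sum_congr rfl fun c _ => ?_
      rw [mul_comm (x c)]
    have h2 : ∑ b, ∑ c, M b c * (x b * x c) =
        (∑ b, ∑ c, w b c * (x b * x c) + ∑ b, ∑ c, w c b * (x b * x c)) / 2 := by
      rw [← Finset.sum_add_distrib, Finset.sum_div]
      refine Finset.sum_congr rfl fun b _ => ?_
      rw [← Finset.sum_add_distrib, Finset.sum_div]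
      refine Finset.sum_congr rfl fun c _ => ?_
      rw [hM, of_apply]; ring
    rw [h2, h1]; ring
  have hpsd : M.PosSemidef := by
    refine Matrix.PosSemidef.of_dotProduct_mulVec_nonneg ?_ fun x => ?_
    · ext b c
      simp [hM, add_comm]
    · have h1 := hw x
      rw [← hsymm] at h1
      have h2 : star x ⬝ᵥ (M *ᵥ x) = ∑ b, ∑ c, M b c * (x b * x c) := by
        simp only [dotProduct, mulVec, Finset.mul_sum, star_trivial]
        refine Finset.sum_congr rfl fun b _ => Finset.sum_congr rfl fun c _ => ?_
        ring
      rwa [h2]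
  -- The symmetrized coefficient matrix is positive semidefinite; the vectors of its rank-one
  -- decomposition are the linear forms to be squared.
  obtain ⟨N, B, hB⟩ := Matrix.posSemidef_iff_eq_sum_vecMulVec.1 hpsd
  have hpoly : ∑ b, ∑ c, C (w b c) * (X b * X c) = ∑ i, linForm (B i) ^ 2 := by
    refine MvPolynomial.funext fun x => ?_
    simp only [map_sum, map_mul, map_pow, eval_C, eval_X, eval_linForm]
    rw [← hsymm, hB]
    simp only [Matrix.sum_apply, vecMulVec_apply, star_trivial, pow_two, Finset.sum_mul,
      Finset.mul_sum]
    conv_rhs => rw [Finset.sum_comm]; enter [2, b]; rw [Finset.sum_comm]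
    rw [Finset.sum_comm]
    refine Finset.sum_congr rfl fun b _ => Finset.sum_congr rfl fun c _ =>
      Finset.sum_congr rfl fun i _ => ?_
    ring
  rw [hpoly]
  exact SoSProves.sum fun i _ => SoSProves.sq (totalDegree_linForm_le _)

/-- `-1 ≤ x ≤ 1` proves `x² ≤ 1`. -/
theorem SoSProves.one_sub_X_sq {𝒞 : Set (MvPolynomial (Fin m) ℝ)} {a : Fin m}
    (h1 : X a + 1 ∈ 𝒞) (h2 : 1 - X a ∈ 𝒞) : SoSProves 𝒞 2 (1 - X a ^ 2) := by
  have e : (1 - X a ^ 2 : MvPolynomial (Fin m) ℝ) = (X a + 1) * (1 - X a) := by ring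
  rw [e]
  refine SoSProves.mul_of_mem h1 h2 (fun h => ?_) ?_
  · have := congrArg (eval fun _ => (1 : ℝ)) h
    norm_num at this
  · refine (totalDegree_mul _ _).trans ?_
    have h3 := totalDegree_add (X a : MvPolynomial (Fin m) ℝ) 1
    have h4 := totalDegree_sub (1 : MvPolynomial (Fin m) ℝ) (X a)
    simp only [totalDegree_X, totalDegree_one] at h3 h4
    omega

/-- Certificate: δ/2 ((1 - x_b²) + (1 - x_c²)) + (δ - ν)/4 (x_b + x_c)² + (δ + ν)/4 (x_b - x_c)². -/
theorem SoSProves.abs_sub_mul_X_mul_X {𝒞 : Set (MvPolynomial (Fin m) ℝ)}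
    (hbox : ∀ a : Fin m, SoSProves 𝒞 2 (1 - X a ^ 2)) {ν δ : ℝ} (hν : |ν| ≤ δ) (b c : Fin m) :
    SoSProves 𝒞 2 (C δ - C ν * (X b * X c)) := by
  have hν' := abs_le.1 hν
  have hd : ∀ s : ℝ, (X b + C s * X c : MvPolynomial (Fin m) ℝ).totalDegree ≤ 1 := fun s =>
    (totalDegree_add _ _).trans (by
      have := totalDegree_C_mul_X_le s c
      simp only [totalDegree_X]; omega)
  have hδ : 0 ≤ δ := (abs_nonneg _).trans hν
  have h := ((((hbox b).add (hbox c)).const_mul (c := δ / 2) (by positivity)).add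
    ((SoSProves.sq (𝒞 := 𝒞) (hd 1)).const_mul (c := (δ - ν) / 4) (by linarith))).add
    ((SoSProves.sq (𝒞 := 𝒞) (hd (-1))).const_mul (c := (δ + ν) / 4) (by linarith))
  convert h using 1
  refine MvPolynomial.funext fun x => ?_
  simp only [map_sub, map_add, map_mul, map_pow, map_one, eval_C, eval_X]
  ring

/-- Certificate: ε/2 (1 - x_b²) + 1/(2ε) ((ε² - u² - v²) + (ε x_b - μu)² + (1 - μ²)u² + v²). -/
theorem SoSProves.sub_X_mul_linForm {𝒞 : Set (MvPolynomial (Fin m) ℝ)}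
    (hbox : ∀ a : Fin m, SoSProves 𝒞 2 (1 - X a ^ 2)) {ε μ : ℝ} (hε : 0 < ε) (hμ : |μ| ≤ 1)
    {u v : Fin m → ℝ} (huv : SoSProves 𝒞 2 (C (ε ^ 2) - (linForm u ^ 2 + linForm v ^ 2)))
    (b : Fin m) : SoSProves 𝒞 2 (C ε - C μ * (X b * linForm u)) := by
  have hμ2 : 0 ≤ 1 - μ ^ 2 := by
    have := abs_le.1 hμ
    nlinarith
  have hd : (C ε * X b - C μ * linForm u).totalDegree ≤ 1 := by
    refine (totalDegree_sub _ _).trans (max_le (totalDegree_C_mul_X_le ε b) ?_)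
    rw [C_mul']
    exact (totalDegree_smul_le _ _).trans (totalDegree_linForm_le u)
  have h := ((hbox b).const_mul (c := ε / 2) (by positivity)).add
    (((huv.add (SoSProves.sq hd)).add
      (((SoSProves.sq (𝒞 := 𝒞) (totalDegree_linForm_le u)).const_mul hμ2).add
        (SoSProves.sq (totalDegree_linForm_le v)))).const_mul (c := 1 / (2 * ε)) (by positivity))
  convert h using 1
  refine MvPolynomial.funext fun x => ?_
  simp only [map_sub, map_add, map_mul, map_pow, map_one, eval_C, eval_X]
  field_simp
  ring

/-- A bound on `x_b u(x)` for a linear form `u`, from an estimate `u'` of `u`. -/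
theorem SoSProves.sub_X_mul_linForm_of_close {𝒞 : Set (MvPolynomial (Fin m) ℝ)}
    (hbox : ∀ a : Fin m, SoSProves 𝒞 2 (1 - X a ^ 2)) {ε δ μ : ℝ} (hε : 0 < ε)
    (hμ : |μ| ≤ 1) {u u' v' : Fin m → ℝ}
    (huv : SoSProves 𝒞 2 (C (ε ^ 2) - (linForm u' ^ 2 + linForm v' ^ 2)))
    (hclose : ∀ c, |u c - u' c| ≤ δ) (b : Fin m) :
    SoSProves 𝒞 2 (C (ε + m * δ) - C μ * (X b * linForm u)) := by
  have h := (SoSProves.sub_X_mul_linForm hbox hε hμ huv b).add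
    (SoSProves.sum (s := Finset.univ) fun c _ => SoSProves.abs_sub_mul_X_mul_X hbox
      (ν := μ * (u c - u' c)) (δ := δ) (by
        rw [abs_mul]
        exact (mul_le_of_le_one_left (abs_nonneg _) hμ).trans (hclose c)) b c)
  convert h using 1
  refine MvPolynomial.funext fun x => ?_
  simp only [map_sub, map_add, map_mul, map_sum, map_natCast, eval_C, eval_X, eval_linForm,
    Finset.sum_sub_distrib, Finset.sum_const, Finset.card_univ, Fintype.card_fin, nsmul_eq_mul,
    Finset.mul_sum, sub_mul, mul_sub]
  have e1 : ∀ f : Fin m → ℝ, ∑ c, μ * f c * (x b * x c) = ∑ c, μ * (x b * (f c * x c)) := fun f =>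
    Finset.sum_congr rfl fun c _ => by ring
  rw [e1, e1]
  ring

end SoS

/-! ### The constraint system -/

section Constraints

variable {n m : ℕ}

theorem normSqPoly_sum (z : Fin m → ℂ) :
    normSqPoly (∑ c, MvPolynomial.C (z c) * MvPolynomial.X c) =
      linForm (fun c => (z c).re) ^ 2 + linForm (fun c => (z c).im) ^ 2 := by
  have key : ∀ f : ℂ →+ ℝ, ∑ e ∈ (∑ c, MvPolynomial.C (z c) * MvPolynomial.X c).support,
      MvPolynomial.monomial e
        (f (MvPolynomial.coeff e (∑ c, MvPolynomial.C (z c) * MvPolynomial.X c))) =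
      linForm fun c => f (z c) := by
    intro f
    classical
    ext e
    rw [MvPolynomial.coeff_sum]
    simp only [MvPolynomial.coeff_monomial, Finset.sum_ite_eq']
    have h1 : MvPolynomial.coeff e (linForm fun c => f (z c)) =
        f (MvPolynomial.coeff e (∑ c, MvPolynomial.C (z c) * MvPolynomial.X c)) := by
      simp only [linForm, MvPolynomial.coeff_sum, map_sum, MvPolynomial.coeff_C_mul,
        MvPolynomial.coeff_X]
      refine Finset.sum_congr rfl fun c _ => ?_
      split_ifs <;> simp
    rw [h1]
    split_ifs with h
    · rfl
    · rw [MvPolynomial.notMem_support_iff.1 h, map_zero]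
  have hre := key Complex.reAddGroupHom
  have him := key Complex.imAddGroupHom
  simp only [Complex.coe_reAddGroupHom, Complex.coe_imAddGroupHom] at hre him
  rw [normSqPoly, hre, him]

theorem extendEst_map_C (T : Op n →ₗ[ℂ] ℂ) (M : Op n) :
    extendEst T (M.map fun z => (MvPolynomial.C z : MvPolynomial (Fin m) ℂ)) =
      MvPolynomial.C (T M) := by
  conv_rhs => rw [Matrix.matrix_eq_sum_single M]
  simp only [extendEst, Matrix.map_apply, map_sum]
  refine Finset.sum_congr rfl fun x _ => Finset.sum_congr rfl fun y _ => ?_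
  rw [← MvPolynomial.C_mul]
  congr 1
  rw [← smul_eq_mul, ← map_smul, Matrix.smul_single, smul_eq_mul, mul_one]

/-- The estimate is linear in λ', so each commutator constraint has degree at most two. -/
theorem extendEst_comm (T : Op n →ₗ[ℂ] ℂ) (E : Fin m → PauliString n) (A₁ A₂ : PauliString n) :
    extendEst T (constOp m A₁ * constOp m A₂ * indetHamiltonian E -
        indetHamiltonian E * constOp m A₁ * constOp m A₂) =
      ∑ c, MvPolynomial.C (T (A₁.op * A₂.op * (E c).op - (E c).op * A₁.op * A₂.op)) *
        MvPolynomial.X c := by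
  have h1 : constOp m A₁ * constOp m A₂ * indetHamiltonian E -
      indetHamiltonian E * constOp m A₁ * constOp m A₂ =
      ∑ c, (MvPolynomial.X c : MvPolynomial (Fin m) ℂ) •
        (A₁.op * A₂.op * (E c).op - (E c).op * A₁.op * A₂.op).map
          (fun z => (MvPolynomial.C z : MvPolynomial (Fin m) ℂ)) := by
    have hC : (fun z : ℂ => (MvPolynomial.C z : MvPolynomial (Fin m) ℂ)) =
      ⇑(MvPolynomial.C : ℂ →+* MvPolynomial (Fin m) ℂ) := rfl
    simp only [indetHamiltonian, constOp, Finset.mul_sum, Finset.sum_mul, mul_smul_comm,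
      smul_mul_assoc, ← Finset.sum_sub_distrib, ← smul_sub, hC]
    refine Finset.sum_congr rfl fun c _ => ?_
    rw [Matrix.map_sub _ (map_sub _)]
    simp only [Matrix.map_mul]
  rw [h1]
  simp only [← extendEst_map_C]
  simp only [extendEst, Matrix.sum_apply, Matrix.smul_apply, smul_eq_mul, Finset.sum_mul]
  conv_lhs => enter [2, x]; rw [Finset.sum_comm]
  rw [Finset.sum_comm]
  refine Finset.sum_congr rfl fun c _ => Finset.sum_congr rfl fun x _ =>
    Finset.sum_congr rfl fun y _ => ?_
  ring

theorem sosProves_box (k : ℕ) (C β ε : ℝ) (E : Fin m → PauliString n) (T : Op n →ₗ[ℂ] ℂ)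
    (a : Fin m) : SoSProves (constraintSystem k C β ε E T) 2 (1 - MvPolynomial.X a ^ 2) :=
  SoSProves.one_sub_X_sq (Or.inl (Or.inl ⟨a, Or.inl rfl⟩)) (Or.inl (Or.inl ⟨a, Or.inr rfl⟩))

theorem sosProves_comm (k : ℕ) (C β ε : ℝ) (E : Fin m → PauliString n) (T : Op n →ₗ[ℂ] ℂ)
    {A₁ A₂ : PauliString n} (h₁ : A₁ ∈ setA k C β ε E) (h₂ : A₂ ∈ setA k C β ε E) :
    SoSProves (constraintSystem k C β ε E T) 2 (MvPolynomial.C (eps0 C β ε m ^ 2) -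
      (linForm (fun c => (T (A₁.op * A₂.op * (E c).op - (E c).op * A₁.op * A₂.op)).re) ^ 2 +
        linForm (fun c => (T (A₁.op * A₂.op * (E c).op - (E c).op * A₁.op * A₂.op)).im) ^ 2)) := by
  refine SoSProves.of_mem (Or.inl (Or.inr ⟨A₁, h₁, A₂, h₂, ?_⟩)) ?_
  · rw [extendEst_comm, normSqPoly_sum]
  · have hsq : ∀ c : Fin m → ℝ, (linForm c ^ 2).totalDegree ≤ 2 := fun c =>
      (MvPolynomial.totalDegree_pow _ _).trans (by have := totalDegree_linForm_le c; omega)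
    refine (MvPolynomial.totalDegree_sub _ _).trans (max_le ((MvPolynomial.totalDegree_C _).le.trans (by norm_num)) ?_)
    exact (MvPolynomial.totalDegree_add _ _).trans (max_le (hsq _) (hsq _))

theorem mem_setA {k d : ℕ} {C β ε : ℝ} {E : Fin m → PauliString n} (hE : IsLowIntersection k d E)
    (hC : (k : ℝ) + 1 ≤ C * β) (hε : 0 < ε) (hε1 : ε < 1) (a : Fin m) :
    E a ∈ setA k C β ε E := by
  refine mem_localPaulis_self ?_ a
  have hk : (0 : ℝ) < k := by
    obtain ⟨i, hi⟩ := Function.ne_iff.1 (hE.ne_one a)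
    have : 0 < (E a).supp.card := Finset.card_pos.2 ⟨i, by simpa [PauliString.supp] using hi⟩
    exact_mod_cast this.trans_le (hE.card_supp a)
  -- Bernoulli's inequality, 4^x ≥ 1 + 3x. With ℓ₀ ≥ 1 it lets the sets defining 𝒜 contain at least
  -- one term.
  have h4 : (k : ℝ) ≤ (4 : ℝ) ^ (C * β) := by
    have := one_add_mul_self_le_rpow_one_add (s := 3) (by norm_num) (p := C * β) (by linarith)
    norm_num at this
    linarith
  have hℓ : (1 : ℝ) ≤ ell0 C β ε := by
    have : 0 < ell0 C β ε := Nat.ceil_pos.2 (mul_pos (by positivity)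
      (Real.log_pos ((one_lt_div hε).2 hε1)))
    exact_mod_cast this
  rw [Nat.one_le_floor_iff, one_le_div hk]
  exact h4.trans (le_mul_of_one_le_right (by positivity) hℓ)

end Constraints

/-! ### The entropy production as a polynomial -/

section Production

open scoped Matrix.Norms.Frobenius

variable {n m k d : ℕ} {E : Fin m → PauliString n}

/-- `tr (E_a E_b [E_c, ρ])`. -/
def commTrace (E : Fin m → PauliString n) (ρ : Op n) (a b c : Fin m) : ℂ :=
  (((E a).op * (E b).op * (E c).op - (E c).op * (E a).op * (E b).op) * ρ).trace

/-- The quadratic form `-tr ([H, H'] [H', ρ])` in `λ'`, which vanishes to second order when `H'`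
commutes with the Gibbs state. -/
def production (E : Fin m → PauliString n) (lam : Fin m → ℝ) (ρ : Op n) :
    MvPolynomial (Fin m) ℝ :=
  ∑ b, ∑ c, MvPolynomial.C (∑ a with b ∈ closedNbr E a,
    -lam a * ((commTrace E ρ a b c).re - (commTrace E ρ b a c).re)) *
      (MvPolynomial.X b * MvPolynomial.X c)

theorem eval_production (lam lam' : Fin m → ℝ) (ρ : Op n) :
    MvPolynomial.eval lam' (production E lam ρ) =
      (Complex.I * ((Complex.I • (hamiltonian E lam * hamiltonian E lam' -
        hamiltonian E lam' * hamiltonian E lam)) *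
          (hamiltonian E lam' * ρ - ρ * hamiltonian E lam')).trace).re := by
  have hab : ∀ a b : Fin m, (((E a).op * (E b).op - (E b).op * (E a).op) *
      (hamiltonian E lam' * ρ - ρ * hamiltonian E lam')).trace =
      ∑ c, (lam' c : ℂ) * (commTrace E ρ a b c - commTrace E ρ b a c) := by
    intro a b
    -- Cyclicity of the trace moves the commutator from ρ to the observable, the form in which the
    -- estimates are given.
    have h1 : ∀ A : Op n, (A * (hamiltonian E lam' * ρ - ρ * hamiltonian E lam')).trace =
        ((A * hamiltonian E lam' - hamiltonian E lam' * A) * ρ).trace := by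
      intro A
      rw [mul_sub, sub_mul, trace_sub, trace_sub, ← mul_assoc, ← mul_assoc, mul_assoc _ A ρ,
        trace_mul_comm (hamiltonian E lam')]
    have h2 : (((E a).op * (E b).op - (E b).op * (E a).op) * hamiltonian E lam' -
        hamiltonian E lam' * ((E a).op * (E b).op - (E b).op * (E a).op)) * ρ =
        ∑ c, (lam' c : ℂ) •
          (((E a).op * (E b).op * (E c).op - (E c).op * (E a).op * (E b).op) * ρ -
            ((E b).op * (E a).op * (E c).op - (E c).op * (E b).op * (E a).op) * ρ) := by
      simp only [hamiltonian, Finset.mul_sum, Finset.sum_mul, mul_smul_comm, smul_mul_assoc,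
        ← Finset.sum_sub_distrib, ← smul_sub]
      refine Finset.sum_congr rfl fun c _ => ?_
      congr 1
      noncomm_ring
    rw [h1, h2, trace_sum]
    refine Finset.sum_congr rfl fun c _ => ?_
    rw [trace_smul, trace_sub, smul_eq_mul, commTrace, commTrace]
  have htr : Complex.I * ((Complex.I • (hamiltonian E lam * hamiltonian E lam' -
        hamiltonian E lam' * hamiltonian E lam)) *
          (hamiltonian E lam' * ρ - ρ * hamiltonian E lam')).trace =
      ∑ a, ∑ b, ∑ c, ((-lam a * (lam' b * lam' c) : ℝ) : ℂ) *
        (commTrace E ρ a b c - commTrace E ρ b a c) := by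
    rw [smul_mul_assoc, trace_smul, smul_eq_mul, ← mul_assoc, Complex.I_mul_I, comm_eq_sum]
    simp only [Finset.sum_mul, trace_sum, smul_mul_assoc, trace_smul, hab, smul_eq_mul,
      Finset.mul_sum]
    refine Finset.sum_congr rfl fun a _ => Finset.sum_congr rfl fun b _ =>
      Finset.sum_congr rfl fun c _ => ?_
    push_cast
    ring
  rw [htr]
  simp only [Complex.re_sum, Complex.re_ofReal_mul, Complex.sub_re]
  simp only [production, map_sum, map_mul, MvPolynomial.eval_C, MvPolynomial.eval_X,
    Finset.sum_mul]
  conv_rhs => rw [Finset.sum_comm]; enter [2, b]; rw [Finset.sum_comm]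
  refine Finset.sum_congr rfl fun b _ => Finset.sum_congr rfl fun c _ => ?_
  rw [Finset.sum_filter]
  refine Finset.sum_congr rfl fun a _ => ?_
  split_ifs with h
  · ring
  -- Pairs outside the closed neighbourhood commute and cancel, so the sum runs over at most m(d+1)
  -- pairs instead of m². This saves a factor of m in the final bound on γ_F².
  · have : commTrace E ρ a b c = commTrace E ρ b a c := by
      rw [commTrace, commTrace, op_mul_comm_of_notMem_closedNbr h, mul_assoc (E c).op,
        op_mul_comm_of_notMem_closedNbr h, ← mul_assoc]
    rw [this, sub_self, mul_zero]

theorem eps0_pos {C β ε : ℝ} (hε : 0 < ε) (hm : 0 < m) : 0 < eps0 C β ε m := by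
  have : (0 : ℝ) < m := by exact_mod_cast hm
  unfold eps0
  positivity

/-- The constraints bound the entropy production. -/
theorem sosProves_production (hE : IsLowIntersection k d E) {lam : Fin m → ℝ}
    (hlam : ∀ a, |lam a| ≤ 1) {C β ε : ℝ} {ρ : Op n} {T : Op n →ₗ[ℂ] ℂ}
    (hC : (k : ℝ) + 1 ≤ C * β) (hε : 0 < ε) (hε1 : ε < 1)
    (hT : AccurateEstimates k C β ε E ρ T) :
    SoSProves (constraintSystem k C β ε E T) 2
      (MvPolynomial.C (6 * (d + 1) * m ^ 2 * eps0 C β ε m) - production E lam ρ) := by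
  classical
  set δ := eps0 C β ε m with hδ
  have hA : ∀ a, E a ∈ setA k C β ε E := mem_setA hE hC hε hε1
  -- δ comes from the constraint, and m * (2 * δ) from replacing each of the m coefficients, a
  -- difference of two traces, by its estimate.
  have hterm : ∀ (a b b' : Fin m) (μ : ℝ), |μ| ≤ 1 → 0 < m →
      SoSProves (constraintSystem k C β ε E T) 2 (MvPolynomial.C (δ + m * (2 * δ)) -
        MvPolynomial.C μ * (MvPolynomial.X b' * linForm fun c => (commTrace E ρ a b c).re)) := by
    intro a b b' μ hμ hm
    refine SoSProves.sub_X_mul_linForm_of_close (sosProves_box k C β ε E T)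
      (eps0_pos hε hm) hμ (sosProves_comm k C β ε E T (hA a) (hA b)) (fun c => ?_) b'
    rw [← Complex.sub_re]
    refine (Complex.abs_re_le_norm _).trans ?_
    have e1 := hT _ (hA a) _ (hA b) _ (hA c)
    have e2 := hT _ (hA c) _ (hA a) _ (hA b)
    have e3 : commTrace E ρ a b c -
        T ((E a).op * (E b).op * (E c).op - (E c).op * (E a).op * (E b).op) =
        (T ((E c).op * (E a).op * (E b).op) - ((E c).op * (E a).op * (E b).op * ρ).trace) -
        (T ((E a).op * (E b).op * (E c).op) - ((E a).op * (E b).op * (E c).op * ρ).trace) := by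
      rw [commTrace, sub_mul, trace_sub, map_sub]; ring
    rw [e3]
    refine (norm_sub_le _ _).trans ?_
    linarith
  have hsum : SoSProves (constraintSystem k C β ε E T) 2 (∑ a, ∑ b ∈ closedNbr E a,
      ((MvPolynomial.C (δ + m * (2 * δ)) - MvPolynomial.C (-lam a) *
        (MvPolynomial.X b * linForm fun c => (commTrace E ρ a b c).re)) +
      (MvPolynomial.C (δ + m * (2 * δ)) - MvPolynomial.C (lam a) *
        (MvPolynomial.X b * linForm fun c => (commTrace E ρ b a c).re)))) :=
    SoSProves.sum fun a _ => SoSProves.sum fun b _ =>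
      (hterm a b b (-lam a) (by rw [abs_neg]; exact hlam a) a.pos).add
        (hterm b a b (lam a) (hlam a) a.pos)
  have hconst : (∑ a, ∑ _b ∈ closedNbr E a, 2 * (δ + m * (2 * δ))) ≤ 6 * (d + 1) * m ^ 2 * δ := by
    rcases Nat.eq_zero_or_pos m with rfl | hm
    · simp
    have hδ0 : 0 < δ := eps0_pos hε hm
    have hm1 : (1 : ℝ) ≤ m := by exact_mod_cast hm
    calc (∑ a, ∑ _b ∈ closedNbr E a, 2 * (δ + m * (2 * δ)))
        ≤ ∑ _a : Fin m, ((d : ℝ) + 1) * (6 * m * δ) := by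
          refine Finset.sum_le_sum fun a _ => ?_
          rw [Finset.sum_const, nsmul_eq_mul]
          refine mul_le_mul (by exact_mod_cast hE.card_closedNbr_le a) ?_ (by positivity)
            (by positivity)
          nlinarith
      _ = 6 * (d + 1) * m ^ 2 * δ := by
          rw [Finset.sum_const, Finset.card_univ, Fintype.card_fin, nsmul_eq_mul]; ring
  have h := hsum.add (SoSProves.const (sub_nonneg.2 hconst))
  convert h using 1
  refine MvPolynomial.funext fun x => ?_
  simp only [production, map_sub, map_add, map_mul, map_sum, MvPolynomial.eval_C,
    MvPolynomial.eval_X, eval_linForm]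
  have e : ∑ a, ∑ b ∈ closedNbr E a,
      (δ + m * (2 * δ) - -lam a * (x b * ∑ c, (commTrace E ρ a b c).re * x c) +
        (δ + m * (2 * δ) - lam a * (x b * ∑ c, (commTrace E ρ b a c).re * x c))) =
      (∑ a, ∑ _b ∈ closedNbr E a, 2 * (δ + m * (2 * δ))) -
      ∑ b, ∑ c, (∑ a with b ∈ closedNbr E a,
        -lam a * ((commTrace E ρ a b c).re - (commTrace E ρ b a c).re)) * (x b * x c) := by
    have e2 : ∑ b, ∑ c, (∑ a with b ∈ closedNbr E a,
        -lam a * ((commTrace E ρ a b c).re - (commTrace E ρ b a c).re)) * (x b * x c) =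
        ∑ a, ∑ b ∈ closedNbr E a, (-lam a * (x b * ∑ c, (commTrace E ρ a b c).re * x c) +
          lam a * (x b * ∑ c, (commTrace E ρ b a c).re * x c)) := by
      simp only [Finset.sum_filter, Finset.sum_mul, ite_mul, zero_mul]
      conv_lhs => enter [2, b]; rw [Finset.sum_comm]
      rw [Finset.sum_comm]
      refine Finset.sum_congr rfl fun a _ => ?_
      have hmem := Finset.sum_ite_mem Finset.univ (closedNbr E a) fun b =>
        (-lam a * (x b * ∑ c, (commTrace E ρ a b c).re * x c) +
          lam a * (x b * ∑ c, (commTrace E ρ b a c).re * x c))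
      rw [Finset.univ_inter] at hmem
      rw [← hmem]
      refine Finset.sum_congr rfl fun b _ => ?_
      split_ifs
      · simp only [Finset.mul_sum, ← Finset.sum_add_distrib]
        exact Finset.sum_congr rfl fun c _ => by ring
      · exact Finset.sum_const_zero
    rw [e2, ← Finset.sum_sub_distrib]
    refine Finset.sum_congr rfl fun a _ => ?_
    rw [← Finset.sum_sub_distrib]
    exact Finset.sum_congr rfl fun b _ => by ring
  rw [e]
  ring

/-- The entropy production dominates the coefficients of `i[H, H']`. -/
theorem sosProves_production_sub {𝒞 : Set (MvPolynomial (Fin m) ℝ)} {lam : Fin m → ℝ} {ρ : Op n}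
    {q : ℝ} {g : MvPolynomial (Fin m) ℝ} (hg : g.IsHomogeneous 1)
    (h : ∀ x, q * MvPolynomial.eval x g ^ 2 ≤ MvPolynomial.eval x (production E lam ρ)) :
    SoSProves 𝒞 2 (production E lam ρ - MvPolynomial.C q * g ^ 2) := by
  obtain ⟨v, rfl⟩ := exists_eq_linForm hg
  set w : Fin m → Fin m → ℝ := fun b c => (∑ a with b ∈ closedNbr E a,
    -lam a * ((commTrace E ρ a b c).re - (commTrace E ρ b a c).re)) - q * (v b * v c) with hw
  have hpoly : production E lam ρ - MvPolynomial.C q * linForm v ^ 2 =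
      ∑ b, ∑ c, MvPolynomial.C (w b c) * (MvPolynomial.X b * MvPolynomial.X c) := by
    rw [linForm, pow_two, Finset.sum_mul_sum]
    simp only [hw, production, Finset.mul_sum, ← Finset.sum_sub_distrib,
      MvPolynomial.C_sub, MvPolynomial.C_mul]
    refine Finset.sum_congr rfl fun b _ => Finset.sum_congr rfl fun c _ => ?_
    ring
  rw [hpoly]
  -- Only nonnegativity at real points is left to check, so the spectral argument itself needs no
  -- algebraic certificate.
  refine SoSProves.quadForm fun x => ?_
  have h1 := h x
  have h2 := congrArg (MvPolynomial.eval x) hpoly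
  simp only [map_sub, map_mul, map_pow, map_sum, MvPolynomial.eval_C, MvPolynomial.eval_X] at h2 h1
  linarith

end Production

end HamLearn

end

theorem mainTheorem10 (k d : ℕ) (β₀ : ℝ) (hβ₀ : 0 < β₀) :
    ∃ C₀ c f : ℝ, 0 < C₀ ∧ 0 < c ∧ 0 < f ∧
      ∀ C : ℝ, C₀ ≤ C →
      ∀ (n m : ℕ) (E : Fin m → HamLearn.PauliString n) (lam : Fin m → ℝ) (β ε : ℝ)
        (T : HamLearn.Op n →ₗ[ℂ] ℂ),
        HamLearn.IsLowIntersection k d E → (∀ a, |lam a| ≤ 1) →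
        β₀ ≤ β → 0 < ε → ε < 1 →
        HamLearn.AccurateEstimates k C β ε E
          (HamLearn.gibbs β (HamLearn.hamiltonian E lam)) T →
        (∃ γ, HamLearn.IsCommutatorExpansion E lam γ) ∧
        ∀ γ, HamLearn.IsCommutatorExpansion E lam γ →
          ∃ ℓ : ℕ, (ℓ : ℝ) ≤ max 2 (Real.log (1 / ε) ^ ((2 : ℝ) ^ (f * β))) ∧
            ∀ F ∈ HamLearn.localPaulis E 2,
              HamLearn.SoSProves (HamLearn.constraintSystem k C β ε E T) ℓ
                (MvPolynomial.C (Real.exp (c * β) * (m : ℝ) ^ (1.5 : ℝ) *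
                  √(HamLearn.eps0 C β ε m)) - γ F) ∧
              HamLearn.SoSProves (HamLearn.constraintSystem k C β ε E T) ℓ
                (γ F + MvPolynomial.C (Real.exp (c * β) * (m : ℝ) ^ (1.5 : ℝ) *
                  √(HamLearn.eps0 C β ε m))) := by
  -- Strings in 𝒫_{2k} have support at most 2k. The added 1 makes the count positive even when k =
  -- 0.
  obtain ⟨κ, Δ, hκ, hΔ, hvar⟩ := HamLearn.exists_variance_bound (2 * k)
    (2 * k * (d + 1) * ((d + 1) * 4 ^ (2 * k)) + 1) (Nat.succ_pos _)
    (h := 2 * (2 * k * (d + 1))) (by positivity)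
  set A : ℝ := 6 * (d + 1) * (1 + 1 / β₀) / κ with hA
  have hA0 : 0 < A := by positivity
  -- C₀ ensures Cβ ≥ k + 1, which puts every E a in 𝒜. Squaring exp (c * β) gives exp (βΔ),
  -- cancelling the loss in the variance bound, times exp (Aβ / β₀) ≥ A, absorbing the constants.
  -- The degree is 2, so any positive f serves.
  refine ⟨(k + 1) / β₀, (Δ + A / β₀) / 2, 1, by positivity, by positivity, one_pos, ?_⟩
  intro C hC n m E lam β ε T hE hlam hβ hε hε1 hT
  refine ⟨HamLearn.exists_isCommutatorExpansion E lam, fun γ hγ =>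
    ⟨2, by simp, fun F hF => ?_⟩⟩
  have hβ0 : 0 < β := hβ₀.trans_le hβ
  have hCβ : (k : ℝ) + 1 ≤ C * β := by
    rw [div_le_iff₀ hβ₀] at hC
    have hC0 : 0 ≤ C := by
      by_contra hneg
      have h1 : C * β₀ < 0 := mul_neg_of_neg_of_pos (not_le.1 hneg) hβ₀
      have h2 : (0 : ℝ) ≤ k := Nat.cast_nonneg k
      linarith
    exact hC.trans (mul_le_mul_of_nonneg_left hβ hC0)
  have hm : 0 < m := by
    obtain ⟨a, -⟩ := HamLearn.mem_localPaulis_two.1 hF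
    exact a.pos
  have hm1 : (1 : ℝ) ≤ m := by exact_mod_cast hm
  have hδ : 0 < HamLearn.eps0 C β ε m := HamLearn.eps0_pos hε hm
  set δ := HamLearn.eps0 C β ε m
  set ρ := HamLearn.gibbs β (HamLearn.hamiltonian E lam) with hρ
  -- The product of the losses in the entropy-production bound and in the variance bound.
  set q := β / (1 + β * m) * (κ * Real.exp (-(β * Δ))) with hq
  have hden : 0 < 1 + β * m := by positivity
  have hq0 : 0 < q := by positivity
  refine HamLearn.SoSProves.bound_of_sq_le (W := HamLearn.production E lam ρ)
    (HamLearn.sosProves_production hE hlam hCβ hε hε1 hT)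
    (HamLearn.sosProves_production_sub (q := q) (hγ.1 F hF) fun x => ?_) hq0 (by positivity) ?_
    (hγ.1 F hF).totalDegree_le
  · obtain ⟨U, e, r, hG, hρU⟩ := HamLearn.exists_gibbsBasis β
      (HamLearn.conjTranspose_hamiltonian E lam)
    have h1 := hG.norm_sq_comm_le hβ0.le (hG.abs_energy_le hlam)
      (HamLearn.conjTranspose_hamiltonian E x) rfl hρU
    rw [← HamLearn.eval_production, hγ.2 x] at h1
    have h2 := hvar (HamLearn.localPaulis E 2) (fun F => MvPolynomial.eval x (γ F)) hβ0.le hG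
      (fun F hF => hE.card_supp_le_of_mem hF)
      (fun R hR => (hE.card_localPaulis_filter_le hR).trans (Nat.le_succ _))
      (fun P hP => hE.norm_comm_mul_le hlam hP hG.norm_root)
      (fun F hF hFI => hγ.coeff_I_eq_zero x hF hFI) F hF
    have h3 := (mul_le_mul_of_nonneg_left h2 hβ0.le).trans h1
    rw [hq, div_mul_eq_mul_div, div_mul_eq_mul_div, div_le_iff₀ hden]
    linarith
  · have hm15 : ((m : ℝ) ^ (1.5 : ℝ)) ^ 2 = (m : ℝ) ^ 3 := by
      rw [← Real.rpow_natCast, ← Real.rpow_mul (by positivity), ← Real.rpow_natCast]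
      norm_num
    have hexp : Real.exp ((Δ + A / β₀) / 2 * β) ^ 2 = Real.exp (β * Δ) * Real.exp (A / β₀ * β) := by
      rw [← Real.exp_nat_mul, ← Real.exp_add]
      congr 1
      push_cast
      ring
    have hAexp : A ≤ Real.exp (A / β₀ * β) := by
      have h1 := Real.add_one_le_exp (A / β₀ * β)
      have h2 : A ≤ A / β₀ * β := by
        rw [div_mul_eq_mul_div, le_div_iff₀ hβ₀]
        exact mul_le_mul_of_nonneg_left hβ hA0.le
      linarith
    rw [mul_pow, mul_pow, Real.sq_sqrt hδ.le, hm15, hexp, hq]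
    have hcancel : Real.exp (-(β * Δ)) * Real.exp (β * Δ) = 1 := by rw [← Real.exp_add]; simp
    have e1 : β / (1 + β * m) * (κ * Real.exp (-(β * Δ))) *
        (Real.exp (β * Δ) * Real.exp (A / β₀ * β) * (m : ℝ) ^ 3 * δ) =
        β * κ * Real.exp (A / β₀ * β) * (m ^ 3 * δ) / (1 + β * m) := by
      rw [← mul_one (β * κ), ← hcancel]; ring
    rw [e1, le_div_iff₀ hden]
    -- Here β ≥ β₀ and m ≥ 1 are used. The extra factor m turns m² into m³, hence the exponent 1.5
    -- after the square root.
    have h4 : 1 + β * m ≤ β * (1 + 1 / β₀) * m := by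
      have h5 : 1 ≤ β * (1 / β₀) := by rw [mul_one_div, one_le_div hβ₀]; exact hβ
      nlinarith
    have hκA : κ * A = 6 * (d + 1) * (1 + 1 / β₀) := by rw [hA]; field_simp
    calc 6 * ((d : ℝ) + 1) * m ^ 2 * δ * (1 + β * m)
        ≤ 6 * ((d : ℝ) + 1) * m ^ 2 * δ * (β * (1 + 1 / β₀) * m) := by gcongr
      _ = β * (κ * A) * (m ^ 3 * δ) := by rw [hκA]; ring
      _ ≤ β * κ * Real.exp (A / β₀ * β) * (m ^ 3 * δ) := by
          rw [← mul_assoc β]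
          gcongr
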